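/- Let $d\ge 1$ and $1<p<\infty$. Let $\Omega\subset\mathbb R^d$ be a $W^{1,p}$-extension domain, that is, an open set for which there are a linear operator $E:W^{1,p}(\Omega)\to W^{1,p}(\mathbb R^d)$ and a constant $C$ with $Eu|_\Omega=u$ and $\|Eu\|_{W^{1,p}(\mathbb R^d)}\le C\|u\|_{W^{1,p}(\Omega)}$ for all $u\in W^{1,p}(\Omega)$, where $\|u\|_{W^{1,p}(\Omega)}^p=\|u\|_{L^p(\Omega)}^p+\|\nabla u\|_{L^p(\Omega)}^p$. Let $(\nu_\varepsilon)_{\varepsilon>0}$ be a family of measurable radial functions $\nu_\varepsilon:\mathbb R^d\setminus\{0\}\to[0,\infty]$ such that, for every $\varepsilon>0$ and every $\delta>0$, $$\int_{\mathbb R^d}(1\wedge|h|^p)\,\nu_\varepsilon(h)\,dh=1\qquad\text{and}\qquad \lim_{\varepsilon\to0}\int_{|h|>\delta}(1\wedge|h|^p)\,\nu_\varepsilon(h)\,dh=0 .$$ For a real-valued $u\in L^p(\Omega)$ put $$A_p:=\liminf_{\varepsilon\to0}\int_\Omega\int_\Omega|u(x)-u(y)|^p\,\nu_\varepsilon(x-y)\,dy\,dx\in[0,\infty].$$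 Then $u\in W^{1,p}(\Omega)$ if and only if $A_p<\infty$. Moreover, for every $u\in L^p(\Omega)$, $$\lim_{\varepsilon\to0}\int_\Omega\int_\Omega|u(x)-u(y)|^p\,\nu_\varepsilon(x-y)\,dy\,dx=K_{d,p}\,\|\nabla u\|_{L^p(\Omega)}^p ,$$ with the convention $\|\nabla u\|_{L^p(\Omega)}=\infty$ if the distributional gradient of $u$ is not in $L^p(\Omega)$. Here $K_{d,p}$ is the mean value of $w\mapsto|w\cdot e|^p$ over the unit sphere $\mathbb S^{d-1}$ with respect to surface measure, where $e\in\mathbb R^d$ is any unit vector (the value does not depend on $e$). -/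

import Mathlib

open MeasureTheory Filter Topology Set
open scoped ENNReal NNReal ContDiff InnerProductSpace

/-- `g` is the weak (distributional) gradient of `u` on the open set `Ω ⊆ ℝᵈ`: both are locally
integrable on `Ω`, and `∫_Ω u ∂ᵢφ = - ∫_Ω gᵢ φ` for all `φ ∈ C_c^∞(Ω)` and all `i`.
Values of `u` and `g` outside `Ω` play no role. -/
structure IsWeakGradient {d : ℕ} (Ω : Set (EuclideanSpace ℝ (Fin d)))
    (u : EuclideanSpace ℝ (Fin d) → ℝ)
    (g : EuclideanSpace ℝ (Fin d) → EuclideanSpace ℝ (Fin d)) : Prop where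
  locallyIntegrableOn : LocallyIntegrableOn u Ω volume
  locallyIntegrableOn_grad : LocallyIntegrableOn g Ω volume
  integral_eq : ∀ φ : EuclideanSpace ℝ (Fin d) → ℝ, ContDiff ℝ ∞ φ → HasCompactSupport φ →
    tsupport φ ⊆ Ω → ∀ i : Fin d,
      ∫ x in Ω, u x * fderiv ℝ φ x (EuclideanSpace.single i 1) = - ∫ x in Ω, g x i * φ x

/-- `g` is a weak gradient of `u` on `Ω` which lies in `L^p(Ω; ℝᵈ)`. -/
def IsLpWeakGradient {d : ℕ} (Ω : Set (EuclideanSpace ℝ (Fin d))) (p : ℝ)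
    (u : EuclideanSpace ℝ (Fin d) → ℝ)
    (g : EuclideanSpace ℝ (Fin d) → EuclideanSpace ℝ (Fin d)) : Prop :=
  IsWeakGradient Ω u g ∧ MemLp g (ENNReal.ofReal p) (volume.restrict Ω)

/-- `u ∈ W^{1,p}(Ω)`: `u ∈ L^p(Ω)` and its distributional gradient lies in `L^p(Ω)`. -/
def MemW1p {d : ℕ} (Ω : Set (EuclideanSpace ℝ (Fin d))) (p : ℝ)
    (u : EuclideanSpace ℝ (Fin d) → ℝ) : Prop :=
  MemLp u (ENNReal.ofReal p) (volume.restrict Ω) ∧ ∃ g, IsLpWeakGradient Ω p u g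

/-- `‖∇u‖_{L^p(Ω)}^p = ∫_Ω |∇u|^p ∈ [0,∞]`, with the convention that it is `∞` if `u` has no weak
gradient in `L^p(Ω)`. (Weak gradients are unique up to null sets, so the infimum runs over the
values at one single class of functions, or over the empty set, where it is `∞`.) -/
noncomputable def gradEnergy {d : ℕ} (Ω : Set (EuclideanSpace ℝ (Fin d))) (p : ℝ)
    (u : EuclideanSpace ℝ (Fin d) → ℝ) : ℝ≥0∞ :=
  ⨅ (g : EuclideanSpace ℝ (Fin d) → EuclideanSpace ℝ (Fin d)) (_ : IsLpWeakGradient Ω p u g),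
    ∫⁻ x in Ω, ‖g x‖ₑ ^ p

/-- The norm `‖u‖_{W^{1,p}(Ω)} = (‖u‖_{L^p(Ω)}^p + ‖∇u‖_{L^p(Ω)}^p)^{1/p}`. -/
noncomputable def w1pNorm {d : ℕ} (Ω : Set (EuclideanSpace ℝ (Fin d))) (p : ℝ)
    (u : EuclideanSpace ℝ (Fin d) → ℝ) : ℝ≥0∞ :=
  ((∫⁻ x in Ω, ‖u x‖ₑ ^ p) + gradEnergy Ω p u) ^ (1 / p)

section WeakGradient

variable {d : ℕ} {Ω : Set (EuclideanSpace ℝ (Fin d))}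

theorem integrableOn_mul_of_tsupport_subset {f ψ : EuclideanSpace ℝ (Fin d) → ℝ}
    (hf : LocallyIntegrableOn f Ω volume) (hψ : Continuous ψ) (hc : HasCompactSupport ψ)
    (hs : tsupport ψ ⊆ Ω) : IntegrableOn (fun x => f x * ψ x) Ω volume := by
  have hK : IsCompact (tsupport ψ) := hc
  have h1 : IntegrableOn (fun x => f x * ψ x) (tsupport ψ) volume :=
    (hf.integrableOn_compact_subset hs hK).mul_continuousOn hψ.continuousOn hK
  have h2 : Integrable (fun x => f x * ψ x) volume := by
    refine (integrableOn_iff_integrable_of_support_subset ?_).1 h1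
    intro x hx
    exact subset_tsupport ψ (fun h0 => hx (by simp [h0]))
  exact h2.integrableOn

theorem locallyIntegrableOn_coord {g : EuclideanSpace ℝ (Fin d) → EuclideanSpace ℝ (Fin d)}
    (hg : LocallyIntegrableOn g Ω volume) (i : Fin d) :
    LocallyIntegrableOn (fun x => g x i) Ω volume := by
  intro x hx
  obtain ⟨s, hs, h⟩ := hg x hx
  exact ⟨s, hs, (EuclideanSpace.proj i : EuclideanSpace ℝ (Fin d) →L[ℝ] ℝ).integrable_comp h⟩

theorem IsWeakGradient.integrable_left {u : EuclideanSpace ℝ (Fin d) → ℝ}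
    {g : EuclideanSpace ℝ (Fin d) → EuclideanSpace ℝ (Fin d)} (h : IsWeakGradient Ω u g)
    {φ : EuclideanSpace ℝ (Fin d) → ℝ} (h1 : ContDiff ℝ ∞ φ) (h2 : HasCompactSupport φ)
    (h3 : tsupport φ ⊆ Ω) (v : EuclideanSpace ℝ (Fin d)) :
    IntegrableOn (fun x => u x * fderiv ℝ φ x v) Ω volume := by
  refine integrableOn_mul_of_tsupport_subset h.locallyIntegrableOn ?_ ?_
    ((tsupport_fderiv_apply_subset ℝ v).trans h3)
  · exact (h1.continuous_fderiv (by simp)).clm_apply continuous_const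
  · exact h2.of_isClosed_subset (isClosed_tsupport _) (tsupport_fderiv_apply_subset ℝ v)

theorem IsWeakGradient.integrable_right {u : EuclideanSpace ℝ (Fin d) → ℝ}
    {g : EuclideanSpace ℝ (Fin d) → EuclideanSpace ℝ (Fin d)} (h : IsWeakGradient Ω u g)
    {φ : EuclideanSpace ℝ (Fin d) → ℝ} (h1 : ContDiff ℝ ∞ φ) (h2 : HasCompactSupport φ)
    (h3 : tsupport φ ⊆ Ω) (i : Fin d) :
    IntegrableOn (fun x => g x i * φ x) Ω volume :=
  integrableOn_mul_of_tsupport_subset (locallyIntegrableOn_coord h.locallyIntegrableOn_grad i)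
    h1.continuous h2 h3

theorem IsWeakGradient.zero :
    IsWeakGradient Ω (fun _ => 0) (fun _ => 0) where
  locallyIntegrableOn := locallyIntegrableOn_zero
  locallyIntegrableOn_grad := locallyIntegrableOn_zero
  integral_eq := by intros; simp

theorem IsWeakGradient.add {u v : EuclideanSpace ℝ (Fin d) → ℝ}
    {g k : EuclideanSpace ℝ (Fin d) → EuclideanSpace ℝ (Fin d)}
    (hu : IsWeakGradient Ω u g) (hv : IsWeakGradient Ω v k) :
    IsWeakGradient Ω (fun x => u x + v x) (fun x => g x + k x) where
  locallyIntegrableOn := hu.locallyIntegrableOn.add hv.locallyIntegrableOn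
  locallyIntegrableOn_grad := hu.locallyIntegrableOn_grad.add hv.locallyIntegrableOn_grad
  integral_eq := by
    intro φ h1 h2 h3 i
    simp only [add_mul, PiLp.add_apply]
    rw [integral_add (hu.integrable_left h1 h2 h3 _) (hv.integrable_left h1 h2 h3 _),
      integral_add (hu.integrable_right h1 h2 h3 i) (hv.integrable_right h1 h2 h3 i),
      hu.integral_eq φ h1 h2 h3 i, hv.integral_eq φ h1 h2 h3 i]
    ring

theorem IsWeakGradient.const_smul {u : EuclideanSpace ℝ (Fin d) → ℝ}
    {g : EuclideanSpace ℝ (Fin d) → EuclideanSpace ℝ (Fin d)}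
    (hu : IsWeakGradient Ω u g) (c : ℝ) :
    IsWeakGradient Ω (fun x => c * u x) (fun x => c • g x) where
  locallyIntegrableOn := hu.locallyIntegrableOn.smul c
  locallyIntegrableOn_grad := hu.locallyIntegrableOn_grad.smul c
  integral_eq := by
    intro φ h1 h2 h3 i
    simp only [PiLp.smul_apply, smul_eq_mul, mul_assoc]
    rw [integral_const_mul, integral_const_mul, hu.integral_eq φ h1 h2 h3 i, mul_neg]

theorem IsWeakGradient.congr {u v : EuclideanSpace ℝ (Fin d) → ℝ}
    {g : EuclideanSpace ℝ (Fin d) → EuclideanSpace ℝ (Fin d)}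
    (hu : IsWeakGradient Ω u g) (h : v =ᵐ[volume.restrict Ω] u) :
    IsWeakGradient Ω v g where
  locallyIntegrableOn := by
    intro x hx
    obtain ⟨s, hs, hi⟩ := hu.locallyIntegrableOn x hx
    refine ⟨s ∩ Ω, inter_mem hs self_mem_nhdsWithin, ?_⟩
    refine (hi.mono_set inter_subset_left).congr ?_
    have h' : v =ᵐ[volume.restrict (s ∩ Ω)] u :=
      h.filter_mono (ae_mono (Measure.restrict_mono inter_subset_right le_rfl))
    exact h'.symm
  locallyIntegrableOn_grad := hu.locallyIntegrableOn_grad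
  integral_eq := by
    intro φ h1 h2 h3 i
    rw [← hu.integral_eq φ h1 h2 h3 i]
    refine integral_congr_ae ?_
    filter_upwards [h] with x hx
    simp only [hx]

end WeakGradient

/-- The Sobolev space `W^{1,p}(Ω)`, as a linear subspace of `L^p(Ω)`. -/
noncomputable def W1p {d : ℕ} (Ω : Set (EuclideanSpace ℝ (Fin d))) (p : ℝ) :
    Submodule ℝ (Lp ℝ (ENNReal.ofReal p) (volume.restrict Ω)) where
  carrier := {u | MemW1p Ω p u}
  zero_mem' := by
    refine ⟨Lp.memLp _, fun _ => 0, ?_, MemLp.zero'⟩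
    exact IsWeakGradient.zero.congr (Lp.coeFn_zero _ _ _)
  add_mem' := by
    rintro u v ⟨-, g, hg, hgp⟩ ⟨-, k, hk, hkp⟩
    exact ⟨Lp.memLp _, fun x => g x + k x, (hg.add hk).congr (Lp.coeFn_add u v), hgp.add hkp⟩
  smul_mem' := by
    rintro c u ⟨-, g, hg, hgp⟩
    exact ⟨Lp.memLp _, fun x => c • g x, (hg.const_smul c).congr (Lp.coeFn_smul c u),
      hgp.const_smul c⟩

/-- `Ω ⊆ ℝᵈ` is a `W^{1,p}`-extension domain: `Ω` is open and there is a bounded linear operator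
`T : W^{1,p}(Ω) → W^{1,p}(ℝᵈ)` with `T u = u` a.e. on `Ω`. -/
def IsW1pExtensionDomain {d : ℕ} (Ω : Set (EuclideanSpace ℝ (Fin d))) (p : ℝ) : Prop :=
  IsOpen Ω ∧ ∃ (T : W1p Ω p →ₗ[ℝ] W1p (univ : Set (EuclideanSpace ℝ (Fin d))) p) (C : ℝ≥0),
    ∀ u : W1p Ω p,
      (∀ᵐ x ∂(volume.restrict Ω), (T u).1 x = u.1 x) ∧
      w1pNorm univ p (T u).1 ≤ C * w1pNorm Ω p u.1

/-- The family `(ν_ε)_{ε>0}` of radial (Lebesgue) measurable functions `ν_ε : ℝᵈ ∖ {0} → [0,∞]` is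
a Dirac approximation of `p`-Lévy measures. (The value of `ν_ε` at the origin is irrelevant.) -/
structure IsDiracApproximation {d : ℕ} (p : ℝ)
    (ν : ℝ → EuclideanSpace ℝ (Fin d) → ℝ≥0∞) : Prop where
  measurable : ∀ ε, 0 < ε → AEMeasurable (ν ε) volume
  radial : ∀ ε, 0 < ε → ∀ h h' : EuclideanSpace ℝ (Fin d), ‖h‖ = ‖h'‖ → ν ε h = ν ε h'
  integral_eq_one : ∀ ε, 0 < ε → ∫⁻ h, ENNReal.ofReal (min 1 (‖h‖ ^ p)) * ν ε h = 1
  tendsto_zero : ∀ δ : ℝ, 0 < δ →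
    Tendsto (fun ε => ∫⁻ h in {h | δ < ‖h‖}, ENNReal.ofReal (min 1 (‖h‖ ^ p)) * ν ε h)
      (𝓝[>] 0) (𝓝 0)

/-- The nonlocal energy `∬_{Ω×Ω} |u(x) - u(y)|^p κ(x - y) dy dx ∈ [0,∞]`. -/
noncomputable def nonlocalEnergy {d : ℕ} (Ω : Set (EuclideanSpace ℝ (Fin d))) (p : ℝ)
    (κ : EuclideanSpace ℝ (Fin d) → ℝ≥0∞) (u : EuclideanSpace ℝ (Fin d) → ℝ) : ℝ≥0∞ :=
  ∫⁻ x in Ω, ∫⁻ y in Ω, ‖u x - u y‖ₑ ^ p * κ (x - y)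

/-- `A_p = liminf_{ε → 0⁺} ∬_{Ω×Ω} |u(x) - u(y)|^p ν_ε(x - y) dx dy ∈ [0,∞]`. -/
noncomputable def liminfEnergy {d : ℕ} (Ω : Set (EuclideanSpace ℝ (Fin d))) (p : ℝ)
    (ν : ℝ → EuclideanSpace ℝ (Fin d) → ℝ≥0∞) (u : EuclideanSpace ℝ (Fin d) → ℝ) : ℝ≥0∞ :=
  liminf (fun ε => nonlocalEnergy Ω p (ν ε) u) (𝓝[>] 0)

/-- The mean value `K_{d,p}` of `w ↦ |w · e|^p` over the unit sphere of `ℝᵈ` with respect to the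
surface measure; it is used for unit vectors `e`, and does not depend on the choice of `e`. -/
noncomputable def sphereConst (d : ℕ) (p : ℝ) (e : EuclideanSpace ℝ (Fin d)) : ℝ :=
  ⨍ w : Metric.sphere (0 : EuclideanSpace ℝ (Fin d)) 1,
    |⟪(w : EuclideanSpace ℝ (Fin d)), e⟫_ℝ| ^ p
    ∂((volume : Measure (EuclideanSpace ℝ (Fin d))).toSphere)

/-! Write `D(h)` for `diffQuotient` and `μ_ε` for the measure `(1 ∧ |h|^p) ν_ε(h) dh`. Substituting
`h = x - y` turns the nonlocal energy into `∫ D dμ_ε`, and the `μ_ε` are radial probability measures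
concentrating at the origin. Only the behaviour of `D` near `0` therefore matters
(`eventually_lintegral_levyMeasure_le_add`), while radiality gives, exactly and for every `ε`, `∫ |v
· h/|h||^p dμ_ε = K_{d,p} |v|^p` (`lintegral_levyMeasure_inner`).

If `u ∈ W^{1,p}(Ω)`, the extension property replaces `u` by a Sobolev function on the whole space.
The identity `u(x) - u(x - h) = ∫₀¹ ∇u(x - th) · h dt` and continuity of translations in `L^p` show
that `D(h)` differs from `∫_Ω |∇u · h/|h||^p` by `o(1)` as `h → 0`. Averaging over `μ_ε` gives the
limit `K_{d,p} ‖∇u‖^p` (`tendsto_nonlocalEnergy`).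

Conversely, let the liminf be finite and let `φ` be a test function. The map `h ↦ ∫ u φ(· + h)` is
differentiable at `0`, with derivative `v ↦ ∫ u ∂_v φ = w · v`. Moving the difference onto `u` and
applying Hölder yields `|w · h/|h||^p ≤ ‖φ‖_q^p D(h) + o(1)`; averaging over `μ_ε` gives `K_{d,p}
|w|^p ≤ ‖φ‖_q^p (A_p + 1)`. As `K_{d,p} > 0`, the distributional gradient is a bounded functional
for the `L^q` norm, and Riesz representation (`exists_memLp_forall_eq_integral`) places it in
`L^p(Ω)`. Hence outside `W^{1,p}(Ω)` the liminf, and with it the limit, is infinite. -/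

/-! ### Radial measures and directional averages -/

section RadialMeasures

variable {E : Type*} [NormedAddCommGroup E] [InnerProductSpace ℝ E] [FiniteDimensional ℝ E]
  [MeasurableSpace E] [BorelSpace E]

/-- Integration in polar coordinates of the product of a radial function and a function of the
direction. -/
theorem exists_lintegral_radial_mul_eq [Nontrivial E] {κ : E → ℝ≥0∞} (hκ : AEMeasurable κ volume)
    (hrad : ∀ h h' : E, ‖h‖ = ‖h'‖ → κ h = κ h') :
    ∃ Z : ℝ≥0∞, ∀ F : E → ℝ≥0∞, Measurable F →
      ∫⁻ w : Metric.sphere (0 : E) 1, F w ∂((volume : Measure E).toSphere) ≠ ⊤ →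
      ∫⁻ h, κ h * F (‖h‖⁻¹ • h) =
        (∫⁻ w : Metric.sphere (0 : E) 1, F w ∂((volume : Measure E).toSphere)) * Z := by
  obtain ⟨e, he⟩ := exists_norm_eq E zero_le_one
  refine ⟨∫⁻ r : Ioi (0 : ℝ), κ ((r : ℝ) • e) ∂(.volumeIoiPow (Module.finrank ℝ E - 1)),
    fun F hF hfin => ?_⟩
  set σ := (volume : Measure E).toSphere
  set ρ := Measure.volumeIoiPow (Module.finrank ℝ E - 1)
  have hmp := (volume : Measure E).measurePreserving_homeomorphUnitSphereProd
  have hemb : MeasurableEmbedding (homeomorphUnitSphereProd E) := Homeomorph.measurableEmbedding _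
  have hr : ∀ x : ({(0 : E)}ᶜ : Set E), κ (((homeomorphUnitSphereProd E x).2 : ℝ) • e) = κ x :=
    fun x => hrad _ _ (by simp [norm_smul, he])
  have h1 : ∫⁻ h, κ h * F (‖h‖⁻¹ • h) = ∫⁻ z : Metric.sphere (0 : E) 1 × Ioi (0 : ℝ),
      κ ((z.2 : ℝ) • e) * F z.1 ∂(σ.prod ρ) := by
    rw [← hmp.lintegral_comp_emb hemb]
    have h2 := lintegral_subtype_comap (μ := volume) (measurableSet_singleton (0 : E)).compl
      (fun h => κ h * F (‖h‖⁻¹ • h))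
    rw [restrict_compl_singleton] at h2
    rw [← h2]
    refine lintegral_congr fun x => ?_
    rw [hr x]
    simp
  have hκ' : AEMeasurable (fun z : Metric.sphere (0 : E) 1 × Ioi (0 : ℝ) => κ ((z.2 : ℝ) • e))
      (σ.prod ρ) := by
    have h2 : AEMeasurable (fun x : ({(0 : E)}ᶜ : Set E) => κ (x : E))
        (Measure.comap (↑) (volume : Measure E)) := by
      have := (MeasurableEmbedding.subtype_coe (measurableSet_singleton (0 : E)).compl)
      refine AEMeasurable.comp_measurable (g := κ) ?_ measurable_subtype_coe
      rw [this.map_comap]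
      exact hκ.mono_measure Measure.restrict_le_self
    rw [← hmp.map_eq, hemb.aemeasurable_map_iff]
    exact h2.congr (Eventually.of_forall fun x => (hr x).symm)
  have hprod : AEMeasurable (fun z : Metric.sphere (0 : E) 1 × Ioi (0 : ℝ) =>
      κ ((z.2 : ℝ) • e) * F z.1) (σ.prod ρ) := hκ'.mul (by fun_prop)
  -- Finiteness of the spherical integral allows it to be pulled out without measurability of `r ↦ κ
  -- (r • e)`.
  rw [h1, lintegral_prod_symm _ hprod, mul_comm, ← lintegral_mul_const' _ _ hfin]
  refine lintegral_congr fun r => ?_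
  have hFm : Measurable fun w : Metric.sphere (0 : E) 1 => F w := hF.comp measurable_subtype_coe
  exact lintegral_const_mul (κ ((r : ℝ) • e)) hFm

/-- The reflection in the hyperplane orthogonal to `v - w` exchanges `v` and `w` and preserves both
the volume and `κ`. -/
theorem lintegral_radial_inner_eq_of_norm_eq {p : ℝ} {κ : E → ℝ≥0∞}
    (hrad : ∀ h h' : E, ‖h‖ = ‖h'‖ → κ h = κ h') {v w : E} (hvw : ‖v‖ = ‖w‖) :
    ∫⁻ h, κ h * ‖⟪v, ‖h‖⁻¹ • h⟫_ℝ‖ₑ ^ p = ∫⁻ h, κ h * ‖⟪w, ‖h‖⁻¹ • h⟫_ℝ‖ₑ ^ p := by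
  set R := (ℝ ∙ (v - w))ᗮ.reflection
  have hR : R v = w := Submodule.reflection_sub hvw
  rw [← R.measurePreserving.lintegral_comp_emb R.toHomeomorph.measurableEmbedding
    (fun h => κ h * ‖⟪w, ‖h‖⁻¹ • h⟫_ℝ‖ₑ ^ p)]
  refine lintegral_congr fun h => ?_
  rw [hrad (R h) h (by simp), R.norm_map, ← map_smul, ← hR, R.inner_map_map]

theorem lintegral_radial_inner_eq_norm_rpow_mul {p : ℝ} (hp : 0 < p) {κ : E → ℝ≥0∞}
    (hrad : ∀ h h' : E, ‖h‖ = ‖h'‖ → κ h = κ h') {e : E} (he : ‖e‖ = 1) (v : E) :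
    ∫⁻ h, κ h * ‖⟪v, ‖h‖⁻¹ • h⟫_ℝ‖ₑ ^ p =
      ‖v‖ₑ ^ p * ∫⁻ h, κ h * ‖⟪e, ‖h‖⁻¹ • h⟫_ℝ‖ₑ ^ p := by
  rw [lintegral_radial_inner_eq_of_norm_eq hrad (w := ‖v‖ • e) (by simp [norm_smul, he]),
    ← lintegral_const_mul' _ _ (ENNReal.rpow_ne_top_of_nonneg hp.le enorm_ne_top)]
  refine lintegral_congr fun h => ?_
  rw [real_inner_smul_left, enorm_mul, ENNReal.mul_rpow_of_nonneg _ _ hp.le, enorm_norm]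
  ring

end RadialMeasures

/-! ### The constant `K_{d,p}` -/

section SphereConst

variable {d : ℕ}

theorem ofReal_sphereConst {p : ℝ} (hp : 0 < p) (hd : 0 < d) (e : EuclideanSpace ℝ (Fin d)) :
    ENNReal.ofReal (sphereConst d p e) =
      (∫⁻ w : Metric.sphere (0 : EuclideanSpace ℝ (Fin d)) 1,
        ‖⟪e, (w : EuclideanSpace ℝ (Fin d))⟫_ℝ‖ₑ ^ p
          ∂((volume : Measure (EuclideanSpace ℝ (Fin d))).toSphere)) /
      (volume : Measure (EuclideanSpace ℝ (Fin d))).toSphere univ := by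
  have : Nonempty (Fin d) := ⟨⟨0, hd⟩⟩
  set σ := (volume : Measure (EuclideanSpace ℝ (Fin d))).toSphere with hσ
  have hσ0 : σ ≠ 0 := Measure.toSphere_ne_zero _
  have hcont : Continuous fun w : Metric.sphere (0 : EuclideanSpace ℝ (Fin d)) 1 =>
      |⟪(w : EuclideanSpace ℝ (Fin d)), e⟫_ℝ| ^ p :=
    Continuous.rpow_const (by fun_prop) fun _ => Or.inr hp.le
  have hint : Integrable (fun w : Metric.sphere (0 : EuclideanSpace ℝ (Fin d)) 1 =>
      |⟪(w : EuclideanSpace ℝ (Fin d)), e⟫_ℝ| ^ p) σ :=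
    hcont.integrable_of_hasCompactSupport (HasCompactSupport.of_compactSpace _)
  rw [sphereConst, average_eq, smul_eq_mul, ENNReal.ofReal_mul (by positivity),
    ENNReal.ofReal_inv_of_pos (by
      rw [Measure.real]; exact ENNReal.toReal_pos (Measure.measure_univ_ne_zero.2 hσ0) (measure_ne_top _ _)),
    ofReal_integral_eq_lintegral_ofReal hint (Eventually.of_forall fun _ => by positivity),
    Measure.real, ENNReal.ofReal_toReal (measure_ne_top _ _), mul_comm, div_eq_mul_inv]
  congr 1
  refine lintegral_congr fun w => ?_
  rw [← ENNReal.ofReal_rpow_of_nonneg (abs_nonneg _) hp.le, real_inner_comm, ← Real.enorm_eq_ofReal_abs]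

theorem lintegral_radial_inner_eq {p : ℝ} (hp : 0 < p) (hd : 0 < d)
    {κ : EuclideanSpace ℝ (Fin d) → ℝ≥0∞} (hκ : AEMeasurable κ volume)
    (hrad : ∀ h h' : EuclideanSpace ℝ (Fin d), ‖h‖ = ‖h'‖ → κ h = κ h') (hone : ∫⁻ h, κ h = 1)
    {e : EuclideanSpace ℝ (Fin d)} (he : ‖e‖ = 1) (v : EuclideanSpace ℝ (Fin d)) :
    ∫⁻ h, κ h * ‖⟪v, ‖h‖⁻¹ • h⟫_ℝ‖ₑ ^ p = ENNReal.ofReal (sphereConst d p e) * ‖v‖ₑ ^ p := by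
  have : Nonempty (Fin d) := ⟨⟨0, hd⟩⟩
  rw [lintegral_radial_inner_eq_norm_rpow_mul hp hrad he, ofReal_sphereConst hp hd, mul_comm]
  congr 1
  obtain ⟨Z, hZ⟩ := exists_lintegral_radial_mul_eq hκ hrad
  set σ := (volume : Measure (EuclideanSpace ℝ (Fin d))).toSphere with hσ
  -- Testing with the constant `1` identifies the radial factor as the reciprocal of the area of the
  -- sphere.
  have h1 := hZ (fun _ => 1) measurable_const (by simp [measure_ne_top])
  simp only [mul_one, hone, lintegral_const, one_mul] at h1
  rw [hZ (fun x => ‖⟪e, x⟫_ℝ‖ₑ ^ p) (by fun_prop), div_eq_mul_inv,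
    ENNReal.eq_inv_of_mul_eq_one_left ((mul_comm _ _).trans h1.symm)]
  refine ne_of_lt (lt_of_le_of_lt (lintegral_mono (g := fun _ => 1) fun w => ?_) (by simp [measure_lt_top]))
  refine ENNReal.rpow_le_one ?_ hp.le
  rw [← ofReal_norm, ENNReal.ofReal_le_one]
  refine (norm_inner_le_norm _ _).trans ?_
  simp [he]

/-- If the constant vanished, the formula for the uniform density on the unit ball would force every
coordinate of almost every `h` in the ball to be zero. Positivity is what makes the converse
direction work and gives `K · ∞ = ∞`. -/
theorem ofReal_sphereConst_ne_zero {p : ℝ} (hp : 0 < p) (hd : 0 < d)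
    {e : EuclideanSpace ℝ (Fin d)} (he : ‖e‖ = 1) : ENNReal.ofReal (sphereConst d p e) ≠ 0 := by
  have : Nonempty (Fin d) := ⟨⟨0, hd⟩⟩
  intro h0
  set κ : EuclideanSpace ℝ (Fin d) → ℝ≥0∞ := fun h =>
    (Metric.ball (0 : EuclideanSpace ℝ (Fin d)) 1).indicator
      (fun _ => (volume (Metric.ball (0 : EuclideanSpace ℝ (Fin d)) 1))⁻¹) h with hκ
  have hone : ∫⁻ h, κ h = 1 := by
    simp only [hκ]
    rw [lintegral_indicator Metric.isOpen_ball.measurableSet, setLIntegral_const]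
    exact ENNReal.inv_mul_cancel (Metric.measure_ball_pos _ _ one_pos).ne' measure_ball_lt_top.ne
  have hmeas : Measurable κ := measurable_const.indicator Metric.isOpen_ball.measurableSet
  have hz : ∀ i : Fin d, ∀ᵐ h, κ h * ‖⟪EuclideanSpace.single i (1 : ℝ), ‖h‖⁻¹ • h⟫_ℝ‖ₑ ^ p = 0 := by
    intro i
    have h1 := lintegral_radial_inner_eq hp hd hmeas.aemeasurable (fun h h' hh => by
      simp [hκ, indicator, hh]) hone he (EuclideanSpace.single i (1 : ℝ))
    rw [h0, zero_mul, lintegral_eq_zero_iff (by fun_prop)] at h1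
    exact h1
  have h2 : ∀ᵐ h, κ h = 0 := by
    filter_upwards [ae_all_iff.2 hz, Measure.ae_ne volume (0 : EuclideanSpace ℝ (Fin d))]
      with h hh hne
    by_contra hk
    apply hne
    ext i
    have := hh i
    simp only [mul_eq_zero, hk, false_or, ENNReal.rpow_eq_zero_iff_of_pos hp] at this
    simpa [inner_smul_right, hne, EuclideanSpace.inner_single_left] using this
  rw [lintegral_congr_ae h2] at hone
  simp at hone

end SphereConst

/-! ### Nonlocal energies as averages of difference quotients -/

section LevyMeasure

/-- The measure `(1 ∧ |h|^p) κ(h) dh`. -/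
noncomputable def levyMeasure {d : ℕ} (p : ℝ) (κ : EuclideanSpace ℝ (Fin d) → ℝ≥0∞) :
    Measure (EuclideanSpace ℝ (Fin d)) :=
  volume.withDensity fun h => ENNReal.ofReal (min 1 (‖h‖ ^ p)) * κ h

/-- The integral over the admissible `x` of `|u(x) - u(x - h)|^p`, divided by `1 ∧ |h|^p`. -/
noncomputable def diffQuotient {d : ℕ} (Ω : Set (EuclideanSpace ℝ (Fin d))) (p : ℝ)
    (u : EuclideanSpace ℝ (Fin d) → ℝ) (h : EuclideanSpace ℝ (Fin d)) : ℝ≥0∞ :=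
  (∫⁻ x in Ω ∩ {x | x - h ∈ Ω}, ‖u x - u (x - h)‖ₑ ^ p) / ENNReal.ofReal (min 1 (‖h‖ ^ p))

variable {d : ℕ} {p : ℝ}

/-- Tonelli after the substitution `h = x - y`; the weight `1 ∧ |h|^p` cancels for every `h ≠ 0`,
hence almost everywhere. -/
theorem nonlocalEnergy_eq_lintegral_diffQuotient (hd : 0 < d)
    {Ω : Set (EuclideanSpace ℝ (Fin d))} (hΩ : MeasurableSet Ω)
    {u : EuclideanSpace ℝ (Fin d) → ℝ} (hu : Measurable u)
    {κ : EuclideanSpace ℝ (Fin d) → ℝ≥0∞} (hκ : AEMeasurable κ volume) :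
    nonlocalEnergy Ω p κ u = ∫⁻ h, diffQuotient Ω p u h ∂(levyMeasure p κ) := by
  have : Nonempty (Fin d) := ⟨⟨0, hd⟩⟩
  set f : EuclideanSpace ℝ (Fin d) → EuclideanSpace ℝ (Fin d) → ℝ≥0∞ := fun x h =>
    Ω.indicator (fun y => ‖u x - u y‖ₑ ^ p) (x - h) with hf
  have hfm : Measurable (Function.uncurry f) := by
    have : Function.uncurry f = ({z | z.1 - z.2 ∈ Ω} : Set (_ × _)).indicator
        fun z => ‖u z.1 - u (z.1 - z.2)‖ₑ ^ p := by
      ext ⟨x, h⟩; simp [hf, indicator]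
    rw [this]
    exact Measurable.indicator (by fun_prop) (measurableSet_preimage (by fun_prop) hΩ)
  have hG : ∀ h, ∫⁻ x in Ω ∩ {x | x - h ∈ Ω}, ‖u x - u (x - h)‖ₑ ^ p = ∫⁻ x in Ω, f x h := by
    intro h
    have hm : MeasurableSet {x | x - h ∈ Ω} := measurableSet_preimage (by fun_prop) hΩ
    rw [inter_comm, ← Measure.restrict_restrict hm, ← lintegral_indicator hm]
    rfl
  have hGm : Measurable fun h => ∫⁻ x in Ω, f x h := hfm.lintegral_prod_left'
  have h1 : nonlocalEnergy Ω p κ u = ∫⁻ x in Ω, ∫⁻ h, f x h * κ h := by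
    refine lintegral_congr fun x => ?_
    rw [← lintegral_indicator hΩ, ← lintegral_sub_left_eq_self _ x]
    refine lintegral_congr fun h => ?_
    simp only [hf, indicator]
    split_ifs <;> simp
  rw [h1, lintegral_lintegral_swap (hfm.aemeasurable.mul hκ.comp_snd), levyMeasure,
    lintegral_withDensity_eq_lintegral_mul₀ (by fun_prop)]
  · refine lintegral_congr_ae ?_
    filter_upwards [Measure.ae_ne volume (0 : EuclideanSpace ℝ (Fin d))] with h hh
    rw [lintegral_mul_const _ (by fun_prop), Pi.mul_apply, diffQuotient, hG, mul_comm,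
      mul_comm (ENNReal.ofReal _), mul_assoc, ENNReal.mul_div_cancel _ ENNReal.ofReal_ne_top]
    have : 0 < ‖h‖ := norm_pos_iff.2 hh
    simpa using Real.rpow_pos_of_pos this p
  · unfold diffQuotient
    simp only [hG]
    fun_prop

theorem lintegral_levyMeasure_inner (hp : 0 < p) (hd : 0 < d)
    {κ : EuclideanSpace ℝ (Fin d) → ℝ≥0∞} (hκ : AEMeasurable κ volume)
    (hrad : ∀ h h' : EuclideanSpace ℝ (Fin d), ‖h‖ = ‖h'‖ → κ h = κ h')
    (hone : ∫⁻ h, ENNReal.ofReal (min 1 (‖h‖ ^ p)) * κ h = 1)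
    {e : EuclideanSpace ℝ (Fin d)} (he : ‖e‖ = 1) (v : EuclideanSpace ℝ (Fin d)) :
    ∫⁻ h, ‖⟪v, ‖h‖⁻¹ • h⟫_ℝ‖ₑ ^ p ∂(levyMeasure p κ) =
      ENNReal.ofReal (sphereConst d p e) * ‖v‖ₑ ^ p := by
  rw [← lintegral_radial_inner_eq hp hd (by fun_prop)
    (fun h h' hh => by rw [hh, hrad h h' hh]) hone he v, levyMeasure,
    lintegral_withDensity_eq_lintegral_mul₀ (by fun_prop) (by fun_prop)]
  rfl

theorem isProbabilityMeasure_levyMeasure {κ : EuclideanSpace ℝ (Fin d) → ℝ≥0∞}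
    (hone : ∫⁻ h, ENNReal.ofReal (min 1 (‖h‖ ^ p)) * κ h = 1) :
    IsProbabilityMeasure (levyMeasure p κ) :=
  ⟨by rw [levyMeasure, withDensity_apply _ MeasurableSet.univ, Measure.restrict_univ, hone]⟩

theorem levyMeasure_absolutelyContinuous (p : ℝ) (κ : EuclideanSpace ℝ (Fin d) → ℝ≥0∞) :
    levyMeasure p κ ≪ volume :=
  withDensity_absolutelyContinuous _ _

/-- The mass away from the origin tends to zero, so a bound near `0` passes to the averages,
boundedness of `Ψ` taking care of the rest. The statement is one-sided so that it serves both halves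
of the limit as well as the converse, where `Φ` need not be bounded. -/
theorem eventually_lintegral_levyMeasure_le_add (hd : 0 < d)
    {ν : ℝ → EuclideanSpace ℝ (Fin d) → ℝ≥0∞} (hν : IsDiracApproximation p ν)
    {Ψ Φ : EuclideanSpace ℝ (Fin d) → ℝ≥0∞} {C : ℝ≥0∞} (hC : C ≠ ⊤) (hΨ : ∀ h ≠ 0, Ψ h ≤ C)
    (hle : ∀ η : ℝ≥0∞, 0 < η → ∀ᶠ h in 𝓝[≠] 0, Ψ h ≤ Φ h + η) {η : ℝ≥0∞} (hη : 0 < η) :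
    ∀ᶠ ε in 𝓝[>] (0 : ℝ),
      ∫⁻ h, Ψ h ∂(levyMeasure p (ν ε)) ≤ ∫⁻ h, Φ h ∂(levyMeasure p (ν ε)) + η := by
  have : Nonempty (Fin d) := ⟨⟨0, hd⟩⟩
  have hη2 : 0 < η / 2 := ENNReal.half_pos hη.ne'
  obtain ⟨r, hr, hr'⟩ := Metric.mem_nhdsWithin_iff.1 (hle (η / 2) hη2)
  -- Half the radius: points with `‖h‖ ≤ r / 2` lie in the open ball on which the local bound holds.
  have hδ : 0 < r / 2 := by positivity
  set S : Set (EuclideanSpace ℝ (Fin d)) := {h | r / 2 < ‖h‖} with hS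
  have hSm : MeasurableSet S := measurableSet_lt measurable_const measurable_norm
  have hlim : Tendsto (fun ε => C * levyMeasure p (ν ε) S) (𝓝[>] 0) (𝓝 (C * 0)) := by
    refine ENNReal.Tendsto.const_mul ?_ (Or.inr hC)
    refine (hν.tendsto_zero _ hδ).congr fun ε => ?_
    rw [levyMeasure, withDensity_apply _ hSm]
  rw [mul_zero] at hlim
  filter_upwards [(tendsto_order.1 hlim).2 _ hη2, self_mem_nhdsWithin] with ε h1 hε
  have hprob := isProbabilityMeasure_levyMeasure (hν.integral_eq_one ε hε)
  have hne : ∀ᵐ h ∂(levyMeasure p (ν ε)), h ≠ 0 :=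
    (levyMeasure_absolutelyContinuous p (ν ε)).ae_le (Measure.ae_ne volume _)
  calc ∫⁻ h, Ψ h ∂(levyMeasure p (ν ε))
      = ∫⁻ h in S, Ψ h ∂(levyMeasure p (ν ε)) + ∫⁻ h in Sᶜ, Ψ h ∂(levyMeasure p (ν ε)) :=
        (lintegral_add_compl _ hSm).symm
    _ ≤ ∫⁻ h in S, C ∂(levyMeasure p (ν ε)) + ∫⁻ h in Sᶜ, Φ h + η / 2 ∂(levyMeasure p (ν ε)) := by
        refine add_le_add (lintegral_mono_ae ?_) (lintegral_mono_ae ?_)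
        · filter_upwards [ae_restrict_of_ae hne] with h hh using hΨ h hh
        · filter_upwards [ae_restrict_of_ae hne, ae_restrict_mem hSm.compl] with h hh hm
          refine hr' ⟨?_, hh⟩
          rw [mem_ball_zero_iff]
          simp only [hS, mem_compl_iff, mem_ofPred_eq, not_lt] at hm
          linarith
    _ ≤ η / 2 + (∫⁻ h, Φ h ∂(levyMeasure p (ν ε)) + η / 2) := by
        refine add_le_add ?_ ?_
        · rw [setLIntegral_const]; exact h1.le
        · refine (setLIntegral_le_lintegral _ _).trans ?_
          rw [lintegral_add_right _ measurable_const, lintegral_const, measure_univ, mul_one]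
    _ = _ := by rw [add_left_comm, ENNReal.add_halves]

end LevyMeasure

/-! ### Uniform convexity and duality of `L^q` -/

section LpDuality

theorem abs_rpow_midpoint_lt {q : ℝ} (hq : 1 < q) {a b : ℝ} (hab : a ≠ b) :
    |(a + b) / 2| ^ q < (|a| ^ q + |b| ^ q) / 2 := by
  have hq0 : 0 < q := one_pos.trans hq
  rcases eq_or_ne |a| |b| with h | h
  · rcases abs_eq_abs.1 h with h | h
    · exact absurd h hab
    · have hb : b ≠ 0 := fun h0 => hab (by simp [h, h0])
      subst h
      have := Real.rpow_pos_of_pos (abs_pos.2 hb) q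
      simp [Real.zero_rpow hq0.ne', this]
  · have h1 := (strictConvexOn_rpow hq).2 (abs_nonneg a) (abs_nonneg b) h
      (by norm_num : (0 : ℝ) < 1 / 2) (by norm_num : (0 : ℝ) < 1 / 2) (by norm_num)
    simp only [smul_eq_mul] at h1
    calc |(a + b) / 2| ^ q ≤ (1 / 2 * |a| + 1 / 2 * |b|) ^ q := by
          refine Real.rpow_le_rpow (abs_nonneg _) ?_ hq0.le
          rw [abs_div, abs_two]
          linarith [abs_add_le a b]
      _ < _ := by linarith

theorem abs_rpow_midpoint_le {q : ℝ} (hq : 1 < q) (a b : ℝ) :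
    |(a + b) / 2| ^ q ≤ (|a| ^ q + |b| ^ q) / 2 := by
  rcases eq_or_ne a b with rfl | h
  · simp
  · exact (abs_rpow_midpoint_lt hq h).le

/-- A quantitative form of the strict convexity of `|·|^q`. -/
theorem exists_abs_sub_rpow_le {q : ℝ} (hq : 1 < q) {η : ℝ} (hη : 0 < η) :
    ∃ C : ℝ, 0 ≤ C ∧ ∀ a b : ℝ, |a - b| ^ q ≤
      η * (|a| ^ q + |b| ^ q) + C * ((|a| ^ q + |b| ^ q) / 2 - |(a + b) / 2| ^ q) := by
  have hq0 : 0 < q := one_pos.trans hq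
  set gap : ℝ × ℝ → ℝ := fun z => (|z.1| ^ q + |z.2| ^ q) / 2 - |(z.1 + z.2) / 2| ^ q with hgap
  have hcont : ∀ f : ℝ × ℝ → ℝ, Continuous f → Continuous fun z => |f z| ^ q := fun f hf =>
    Continuous.rpow_const hf.abs fun _ => Or.inr hq0.le
  have hgc : Continuous gap :=
    (((hcont _ continuous_fst).add (hcont _ continuous_snd)).div_const 2).sub
      (hcont _ (by fun_prop))
  have hdc : Continuous fun z : ℝ × ℝ => |z.1 - z.2| ^ q := hcont _ (by fun_prop)
  have hgap0 : ∀ z, 0 ≤ gap z := fun z => sub_nonneg.2 (abs_rpow_midpoint_le hq z.1 z.2)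
  -- On this compact set the two coordinates differ, so the convexity gap has a positive minimum
  -- there; on the rest of the sphere the term `η` suffices. Homogeneity of degree `q` extends the
  -- estimate to all pairs.
  set K : Set (ℝ × ℝ) := Metric.sphere 0 1 ∩ {z | η ≤ |z.1 - z.2| ^ q} with hK
  have hKc : IsCompact K := (isCompact_sphere _ _).inter_right (isClosed_le continuous_const hdc)
  have hone : ∀ z ∈ Metric.sphere (0 : ℝ × ℝ) 1, 1 ≤ |z.1| ^ q + |z.2| ^ q := by
    intro z hz
    rw [mem_sphere_zero_iff_norm, Prod.norm_def] at hz
    rcases max_choice ‖z.1‖ ‖z.2‖ with h | h <;> rw [h, Real.norm_eq_abs] at hz <;> rw [hz] <;>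
      simp <;> positivity
  have hsphere : ∃ C : ℝ, 0 ≤ C ∧ ∀ z ∈ Metric.sphere (0 : ℝ × ℝ) 1,
      |z.1 - z.2| ^ q ≤ η + C * gap z := by
    rcases K.eq_empty_or_nonempty with h | h
    · refine ⟨0, le_rfl, fun z hz => ?_⟩
      by_contra! hlt
      have : z ∈ K := ⟨hz, by simp at hlt; exact hlt.le⟩
      simp [h] at this
    · obtain ⟨z₀, hz₀, hmin⟩ := hKc.exists_isMinOn h hgc.continuousOn
      obtain ⟨z₁, hz₁, hmax⟩ := hKc.exists_isMaxOn h hdc.continuousOn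
      have hpos : 0 < gap z₀ := by
        refine sub_pos.2 (abs_rpow_midpoint_lt hq fun heq => ?_)
        have := hz₀.2
        simp [heq, Real.zero_rpow hq0.ne'] at this
        linarith
      refine ⟨|z₁.1 - z₁.2| ^ q / gap z₀, by positivity, fun z hz => ?_⟩
      by_cases hzK : z ∈ K
      · have h1 : |z.1 - z.2| ^ q ≤ |z₁.1 - z₁.2| ^ q := hmax hzK
        have h2 : gap z₀ ≤ gap z := hmin hzK
        calc |z.1 - z.2| ^ q ≤ |z₁.1 - z₁.2| ^ q / gap z₀ * gap z₀ := by
              rw [div_mul_cancel₀ _ hpos.ne']; exact h1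
          _ ≤ |z₁.1 - z₁.2| ^ q / gap z₀ * gap z := by gcongr
          _ ≤ _ := by linarith
      · have : |z.1 - z.2| ^ q < η := by
          by_contra! hle
          exact hzK ⟨hz, hle⟩
        have := mul_nonneg (by positivity : 0 ≤ |z₁.1 - z₁.2| ^ q / gap z₀) (hgap0 z)
        linarith
  obtain ⟨C, hC, hCs⟩ := hsphere
  refine ⟨C, hC, fun a b => ?_⟩
  rcases eq_or_ne ((a, b) : ℝ × ℝ) 0 with h0 | h0
  · obtain ⟨rfl, rfl⟩ := Prod.mk_eq_zero.1 h0
    simp [Real.zero_rpow hq0.ne']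
  · set s := ‖((a, b) : ℝ × ℝ)‖ with hs
    have hs0 : 0 < s := norm_pos_iff.2 h0
    have hz : s⁻¹ • ((a, b) : ℝ × ℝ) ∈ Metric.sphere (0 : ℝ × ℝ) 1 := by
      rw [mem_sphere_zero_iff_norm, norm_smul, norm_inv, norm_norm, inv_mul_cancel₀ hs0.ne']
    have h1 := hCs _ hz
    have h2 := hone _ hz
    have hsc : ∀ x : ℝ, |x| ^ q = s ^ q * |s⁻¹ * x| ^ q := by
      intro x
      rw [abs_mul, Real.mul_rpow (abs_nonneg _) (abs_nonneg _), ← mul_assoc,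
        ← Real.mul_rpow hs0.le (abs_nonneg _), abs_of_pos (inv_pos.2 hs0),
        mul_inv_cancel₀ hs0.ne', Real.one_rpow, one_mul]
    simp only [Prod.smul_mk, smul_eq_mul, hgap] at h1 h2
    rw [hsc (a - b), hsc a, hsc b, hsc ((a + b) / 2), mul_sub,
      show s⁻¹ * ((a + b) / 2) = (s⁻¹ * a + s⁻¹ * b) / 2 by ring]
    have hsq : 0 < s ^ q := Real.rpow_pos_of_pos hs0 q
    have h3 := mul_le_mul_of_nonneg_left (h1.trans (add_le_add_left (le_mul_of_one_le_right hη.le h2) _))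
      hsq.le
    linarith

variable {α : Type*} [MeasurableSpace α] {μ : Measure α}

theorem Lp.norm_rpow_eq_integral {q : ℝ} (hq : 1 < q) (f : Lp ℝ (ENNReal.ofReal q) μ) :
    ‖f‖ ^ q = ∫ x, |f x| ^ q ∂μ := by
  have hq0 : 0 < q := one_pos.trans hq
  rw [Lp.norm_def, (Lp.memLp f).eLpNorm_eq_integral_rpow_norm (by simpa) ENNReal.ofReal_ne_top,
    ENNReal.toReal_ofReal hq0.le, ENNReal.toReal_ofReal (by positivity),
    ← Real.rpow_mul (by positivity), inv_mul_cancel₀ hq0.ne', Real.rpow_one]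
  rfl

theorem Lp.integrable_abs_rpow {q : ℝ} (hq : 1 < q) (f : Lp ℝ (ENNReal.ofReal q) μ) :
    Integrable (fun x => |f x| ^ q) μ := by
  have := (Lp.memLp f).integrable_norm_rpow (by simpa using one_pos.trans hq) ENNReal.ofReal_ne_top
  rwa [ENNReal.toReal_ofReal (one_pos.trans hq).le] at this

/-- Uniform convexity of `L^q`. -/
theorem exists_Lp_norm_sub_rpow_le {q : ℝ} (hq : 1 < q) {η : ℝ} (hη : 0 < η) :
    ∃ C : ℝ, 0 ≤ C ∧ ∀ f g : Lp ℝ (ENNReal.ofReal q) μ, ‖f - g‖ ^ q ≤ η * (‖f‖ ^ q + ‖g‖ ^ q) +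
      C * ((‖f‖ ^ q + ‖g‖ ^ q) / 2 - ‖(2 : ℝ)⁻¹ • (f + g)‖ ^ q) := by
  obtain ⟨C, hC, h⟩ := exists_abs_sub_rpow_le hq hη
  refine ⟨C, hC, fun f g => ?_⟩
  have hi := fun k : Lp ℝ (ENNReal.ofReal q) μ => Lp.integrable_abs_rpow hq k
  have hs : Integrable (fun x => |f x| ^ q + |g x| ^ q) μ := (hi f).add (hi g)
  have hd : Integrable (fun x => (|f x| ^ q + |g x| ^ q) / 2) μ := hs.div_const 2
  have hG : Integrable (fun x => (|f x| ^ q + |g x| ^ q) / 2 -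
    |((2 : ℝ)⁻¹ • (f + g) : Lp ℝ (ENNReal.ofReal q) μ) x| ^ q) μ := hd.sub (hi _)
  simp only [Lp.norm_rpow_eq_integral hq]
  rw [← integral_add (hi f) (hi g), ← integral_div, ← integral_sub hd (hi _),
    ← integral_const_mul, ← integral_const_mul, ← integral_add (hs.const_mul η) (hG.const_mul C)]
  refine integral_mono_ae (hi _) ((hs.const_mul η).add (hG.const_mul C)) ?_
  filter_upwards [Lp.coeFn_sub f g, Lp.coeFn_smul (2 : ℝ)⁻¹ (f + g), Lp.coeFn_add f g]
    with x h1 h2 h3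
  simp only [h1, h2, h3, Pi.add_apply, Pi.sub_apply, Pi.smul_apply, smul_eq_mul]
  have := h (f x) (g x)
  rwa [div_eq_inv_mul (f x + g x)] at this

/-- Coercivity: since `q > 1`, the energy beats any linear term. It makes the variational problem
below bounded from below, with bounded minimizing sequences. -/
theorem exists_forall_le_rpow_div_sub {q : ℝ} (hq : 1 < q) (M : ℝ) :
    ∃ R : ℝ, 0 ≤ R ∧ ∀ x, R ≤ x → x ≤ x ^ q / q - M * x := by
  have hq0 : 0 < q := one_pos.trans hq
  have h := (tendsto_rpow_atTop (sub_pos.2 hq)).eventually_ge_atTop (q * (M + 1))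
  obtain ⟨R, hR⟩ := eventually_atTop.1 h
  refine ⟨max R 1, by positivity, fun x hx => ?_⟩
  have hx0 : 0 < x := by linarith [le_max_right R 1]
  have h1 := hR x ((le_max_left _ _).trans hx)
  have h2 : x ^ q = x ^ (q - 1) * x := by
    rw [← Real.rpow_add_one hx0.ne']; congr 1; ring
  have h3 := mul_le_mul_of_nonneg_right h1 hx0.le
  rw [← h2] at h3
  have h4 : (M + 1) * x ≤ x ^ q / q := by rw [le_div_iff₀ hq0]; linarith
  linarith

/-- A functional which is bounded by the `L^q` norm is dominated by a difference of `q`-energies at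
the minimizer of `‖f‖^q / q - ℓ f`. -/
theorem exists_Lp_le_rpow_sub_rpow {q : ℝ} (hq : 1 < q) {T : Type*} [AddCommGroup T] [Module ℝ T]
    (ι : T →ₗ[ℝ] Lp ℝ (ENNReal.ofReal q) μ) (ℓ : T →ₗ[ℝ] ℝ) {M : ℝ} (hM : 0 ≤ M)
    (hℓ : ∀ t, |ℓ t| ≤ M * ‖ι t‖) :
    ∃ f : Lp ℝ (ENNReal.ofReal q) μ, ∀ t, ℓ t ≤ ‖f + ι t‖ ^ q / q - ‖f‖ ^ q / q := by
  have hq0 : 0 < q := one_pos.trans hq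
  have : Fact (1 ≤ ENNReal.ofReal q) := ⟨by simpa using hq.le⟩
  set J : T → ℝ := fun t => ‖ι t‖ ^ q / q - ℓ t with hJ
  obtain ⟨R, hR0, hR⟩ := exists_forall_le_rpow_div_sub hq M
  have hJlow : ∀ t, ‖ι t‖ ^ q / q - M * ‖ι t‖ ≤ J t := fun t => by
    have := (abs_le.1 (hℓ t)).2
    simp only [hJ]; linarith
  have hbdd : BddBelow (range J) := by
    refine ⟨-(M * R), ?_⟩
    rintro _ ⟨t, rfl⟩
    refine le_trans ?_ (hJlow t)
    rcases le_total R ‖ι t‖ with h | h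
    · have := hR _ h
      have := mul_nonneg hM hR0
      linarith [norm_nonneg (ι t)]
    · have : 0 ≤ ‖ι t‖ ^ q / q := by positivity
      nlinarith
  set I := sInf (range J) with hI
  have hIle : ∀ t, I ≤ J t := fun t => csInf_le hbdd ⟨t, rfl⟩
  have hex : ∀ n : ℕ, ∃ t, J t < I + 1 / ((n : ℝ) + 1) := fun n => by
    obtain ⟨_, ⟨t, rfl⟩, ht⟩ := exists_lt_of_csInf_lt (range_nonempty J)
      (lt_add_of_pos_right I (Nat.one_div_pos_of_nat (α := ℝ) (n := n)))
    exact ⟨t, ht⟩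
  choose φ hφ using hex
  have hφ1 : ∀ N n : ℕ, N ≤ n → J (φ n) < I + 1 / ((N : ℝ) + 1) := fun N n hn =>
    (hφ n).trans_le (by gcongr)
  set B := max R (I + 1) with hB
  have hB0 : 0 ≤ B := hR0.trans (le_max_left _ _)
  have hbound : ∀ n, ‖ι (φ n)‖ ≤ B := by
    intro n
    rcases le_total R ‖ι (φ n)‖ with h | h
    · have h1 := hR _ h
      have h2 := hφ1 0 n n.zero_le
      have h3 := hJlow (φ n)
      norm_num at h2
      exact le_max_of_le_right (by linarith)
    · exact h.trans (le_max_left _ _)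
  -- The linear part of `J` cancels at the midpoint, so the convexity gap is controlled by how far
  -- `s` and `t` are from minimizing. Uniform convexity then makes a minimizing sequence Cauchy.
  have hgap : ∀ s t : T, (‖ι s‖ ^ q + ‖ι t‖ ^ q) / 2 - ‖(2 : ℝ)⁻¹ • (ι s + ι t)‖ ^ q ≤
      q * ((J s + J t) / 2 - I) := by
    intro s t
    have h1 := hIle ((2 : ℝ)⁻¹ • (s + t))
    simp only [hJ, map_smul, map_add, smul_eq_mul] at h1 ⊢
    have h2 := mul_le_mul_of_nonneg_left h1 hq0.le
    rw [mul_sub, mul_div_cancel₀ _ hq0.ne'] at h2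
    have h3 : q * ((‖ι s‖ ^ q / q - ℓ s + (‖ι t‖ ^ q / q - ℓ t)) / 2 - I) =
      (‖ι s‖ ^ q + ‖ι t‖ ^ q) / 2 - q * (2⁻¹ * (ℓ s + ℓ t)) - q * I := by
      field_simp
      ring
    rw [h3]
    linarith
  have hcauchy : CauchySeq fun n => ι (φ n) := by
    rw [Metric.cauchySeq_iff]
    intro δ hδ
    have hδq : 0 < δ ^ q := Real.rpow_pos_of_pos hδ q
    have hBq : 0 ≤ B ^ q := by positivity
    -- With all norms at most `B`, this `η` makes the first term at most `δ ^ q / 2`; the `N` chosen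
    -- next makes the gap term smaller than `δ ^ q / 2`.
    obtain ⟨C, hC, h⟩ := exists_Lp_norm_sub_rpow_le (μ := μ) hq
      (η := δ ^ q / (4 * (B ^ q + 1))) (by positivity)
    obtain ⟨N, hN⟩ := exists_nat_one_div_lt (show 0 < δ ^ q / (2 * (C * q + 1)) by positivity)
    refine ⟨N, fun m hm n hn => ?_⟩
    have hb : ∀ n, ‖ι (φ n)‖ ^ q ≤ B ^ q := fun n =>
      Real.rpow_le_rpow (norm_nonneg _) (hbound n) hq0.le
    have h1 : ‖ι (φ m) - ι (φ n)‖ ^ q < δ ^ q := by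
      refine (h _ _).trans_lt ?_
      have h2 : δ ^ q / (4 * (B ^ q + 1)) * (‖ι (φ m)‖ ^ q + ‖ι (φ n)‖ ^ q) ≤ δ ^ q / 2 := by
        rw [div_mul_eq_mul_div, div_le_iff₀ (by positivity)]
        nlinarith [hb m, hb n]
      have h3 := hgap (φ m) (φ n)
      have h4 : q * ((J (φ m) + J (φ n)) / 2 - I) ≤ q * (1 / ((N : ℝ) + 1)) := by
        refine mul_le_mul_of_nonneg_left ?_ hq0.le
        linarith [hφ1 N m hm, hφ1 N n hn]
      have h5 : C * ((‖ι (φ m)‖ ^ q + ‖ι (φ n)‖ ^ q) / 2 - ‖(2 : ℝ)⁻¹ • (ι (φ m) + ι (φ n))‖ ^ q)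
          ≤ C * q * (1 / ((N : ℝ) + 1)) := by
        rw [mul_assoc]
        exact mul_le_mul_of_nonneg_left (h3.trans h4) hC
      have h6 : C * q * (1 / ((N : ℝ) + 1)) < δ ^ q / 2 := by
        have hCq : 0 ≤ C * q := by positivity
        calc C * q * (1 / ((N : ℝ) + 1)) ≤ (C * q) * (δ ^ q / (2 * (C * q + 1))) := by gcongr
          _ < (C * q + 1) * (δ ^ q / (2 * (C * q + 1))) := by gcongr; linarith
          _ = δ ^ q / 2 := by field_simp
      linarith
    rw [dist_eq_norm]
    exact (Real.rpow_lt_rpow_iff (norm_nonneg _) hδ.le hq0).1 h1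
  obtain ⟨f, hf⟩ := cauchySeq_tendsto_of_complete hcauchy
  refine ⟨f, fun t => ?_⟩
  have hcont : Continuous fun g : Lp ℝ (ENNReal.ofReal q) μ => ‖g‖ ^ q / q :=
    (Continuous.rpow_const continuous_norm fun _ => Or.inr hq0.le).div_const q
  have h1 : Tendsto (fun n : ℕ => ‖ι (φ n)‖ ^ q / q - 1 / ((n : ℝ) + 1)) atTop
      (𝓝 (‖f‖ ^ q / q - 0)) :=
    ((hcont.tendsto f).comp hf).sub tendsto_one_div_add_atTop_nhds_zero_nat
  have h2 : Tendsto (fun n : ℕ => ‖ι (φ n) + ι t‖ ^ q / q - ℓ t) atTop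
      (𝓝 (‖f + ι t‖ ^ q / q - ℓ t)) :=
    ((hcont.tendsto _).comp (hf.add_const (ι t))).sub_const _
  -- The limit `f` lies in the closure of the range of `ι`, where `ℓ` is not defined; hence `φ n` is
  -- compared with `φ n + t` before passing to the limit.
  have h3 := le_of_tendsto_of_tendsto' h1 h2 fun n => by
    have h4 := hIle (φ n + t)
    have h5 := hφ n
    simp only [hJ, map_add] at h4 h5
    linarith
  linarith

/-- The Gateaux derivative of the `q`-energy on `L^q`. -/
theorem hasDerivAt_integral_abs_add_mul_rpow {q : ℝ} (hq : 1 < q)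
    (f g : Lp ℝ (ENNReal.ofReal q) μ) :
    HasDerivAt (fun s : ℝ => ∫ x, |f x + s * g x| ^ q ∂μ)
      (∫ x, q * (|f x| ^ (q - 2) * f x) * g x ∂μ) 0 := by
  have hq0 : 0 < q := one_pos.trans hq
  have hfm := (Lp.stronglyMeasurable f).measurable
  have hgm := (Lp.stronglyMeasurable g).measurable
  have hbd : Integrable (fun x => q * (|f x| + |g x|) ^ q) μ := by
    have h1 : MemLp (fun x => |f x| + |g x|) (ENNReal.ofReal q) μ :=
      (Lp.memLp f).abs.add (Lp.memLp g).abs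
    have h2 := h1.integrable_norm_rpow (by simpa) ENNReal.ofReal_ne_top
    rw [ENNReal.toReal_ofReal hq0.le] at h2
    refine (h2.const_mul q).congr (Eventually.of_forall fun x => ?_)
    simp only [Real.norm_eq_abs]
    rw [abs_of_nonneg (add_nonneg (abs_nonneg _) (abs_nonneg _))]
  have := (hasDerivAt_integral_of_dominated_loc_of_deriv_le (μ := μ)
    (F := fun s x => |f x + s * g x| ^ q)
    (F' := fun s x => q * |f x + s * g x| ^ (q - 2) * (f x + s * g x) * g x)
    (x₀ := (0 : ℝ)) (s := Metric.ball 0 1) (bound := fun x => q * (|f x| + |g x|) ^ q)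
    (Metric.ball_mem_nhds _ one_pos) ?_ ?_ ?_ ?_ hbd ?_).2
  · refine this.congr_deriv ?_
    simp [mul_assoc]
  · exact Eventually.of_forall fun s => Measurable.aestronglyMeasurable (by fun_prop)
  · simpa using Lp.integrable_abs_rpow hq f
  · exact Measurable.aestronglyMeasurable (by fun_prop)
  · refine Eventually.of_forall fun x s hs => ?_
    have hs1 : |s| ≤ 1 := by simpa using (mem_ball_zero_iff.1 hs).le
    have h1 : |f x + s * g x| ≤ |f x| + |g x| := by
      refine (abs_add_le _ _).trans (add_le_add_right ?_ _)
      rw [abs_mul]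
      exact mul_le_of_le_one_left (abs_nonneg _) hs1
    set y := f x + s * g x
    -- At `y = 0` the factor `|y|` makes the product vanish, whatever value `0 ^ (q - 2)` has.
    have h2 : |y| ^ (q - 2) * |y| = |y| ^ (q - 1) := by
      rcases eq_or_ne y 0 with h | h
      · simp [h, Real.zero_rpow (sub_pos.2 hq).ne']
      · rw [← Real.rpow_add_one (abs_pos.2 h).ne']; congr 1; ring
    set A := |f x| + |g x| with hA
    have hA0 : 0 ≤ A := by positivity
    have h3 : A ^ (q - 1) * A = A ^ q := by
      rcases hA0.eq_or_lt with h | h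
      · simp [← h, Real.zero_rpow hq0.ne']
      · rw [← Real.rpow_add_one h.ne']; congr 1; ring
    rw [Real.norm_eq_abs, abs_mul, abs_mul, abs_mul, abs_of_pos hq0,
      abs_of_nonneg (Real.rpow_nonneg (abs_nonneg y) _), mul_assoc q, h2, mul_assoc, ← h3]
    have h4 : |y| ^ (q - 1) ≤ A ^ (q - 1) :=
      Real.rpow_le_rpow (abs_nonneg _) h1 (sub_pos.2 hq).le
    have h5 : |g x| ≤ A := by simp [hA]
    gcongr
  · refine Eventually.of_forall fun x s _ => ?_
    have h1 : HasDerivAt (fun s : ℝ => f x + s * g x) (g x) s := by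
      simpa using ((hasDerivAt_id s).mul_const (g x)).const_add (f x)
    exact (hasDerivAt_abs_rpow _ hq).comp s h1

/-- **Riesz representation** of functionals which are bounded by the `L^q` norm. -/
theorem exists_memLp_forall_eq_integral {p q : ℝ} (hpq : p.HolderConjugate q)
    {T : Type*} [AddCommGroup T] [Module ℝ T]
    (ι : T →ₗ[ℝ] Lp ℝ (ENNReal.ofReal q) μ) (ℓ : T →ₗ[ℝ] ℝ) {M : ℝ} (hM : 0 ≤ M)
    (hℓ : ∀ t, |ℓ t| ≤ M * ‖ι t‖) :
    ∃ g : α → ℝ, MemLp g (ENNReal.ofReal p) μ ∧ ∀ t, ℓ t = ∫ x, g x * ι t x ∂μ := by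
  have hq : 1 < q := hpq.symm.lt
  have hq0 : 0 < q := hpq.symm.pos
  have hp0 : 0 < p := hpq.pos
  obtain ⟨f, hf⟩ := exists_Lp_le_rpow_sub_rpow hq ι ℓ hM hℓ
  have hfm := (Lp.stronglyMeasurable f).measurable
  -- The representative is the derivative of the `q`-energy at the minimizer, divided by `q`; the
  -- representation formula is the Euler–Lagrange equation. Neither Hahn–Banach nor σ-finiteness is
  -- needed.
  refine ⟨fun x => |f x| ^ (q - 2) * f x, ?_, fun t => ?_⟩
  · rw [← integrable_norm_rpow_iff (Measurable.aestronglyMeasurable (by fun_prop)) (by simpa)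
      ENNReal.ofReal_ne_top, ENNReal.toReal_ofReal hp0.le]
    refine (Lp.integrable_abs_rpow hq f).congr (Eventually.of_forall fun x => ?_)
    simp only [Real.norm_eq_abs, abs_mul]
    rcases eq_or_ne (f x) 0 with h | h
    · simp [h, Real.zero_rpow hq0.ne', Real.zero_rpow hp0.ne']
    · rw [abs_of_nonneg (Real.rpow_nonneg (abs_nonneg (f x)) _),
        ← Real.rpow_add_one (abs_pos.2 h).ne', ← Real.rpow_mul (abs_nonneg _)]
      congr 1
      have := hpq.symm.sub_one_mul_conj
      linarith
  · have hd := hasDerivAt_integral_abs_add_mul_rpow hq f (ι t)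
    have hF : ∀ s : ℝ, ∫ x, |f x + s * ι t x| ^ q ∂μ = ‖f + ι (s • t)‖ ^ q := by
      intro s
      rw [Lp.norm_rpow_eq_integral hq, map_smul]
      refine integral_congr_ae ?_
      filter_upwards [Lp.coeFn_add f (s • ι t), Lp.coeFn_smul s (ι t)] with x h1 h2
      rw [h1, Pi.add_apply, h2, Pi.smul_apply, smul_eq_mul]
    have hd2 : HasDerivAt (fun s : ℝ => (∫ x, |f x + s * ι t x| ^ q ∂μ) / q - s * ℓ t)
        ((∫ x, q * (|f x| ^ (q - 2) * f x) * ι t x ∂μ) / q - ℓ t) 0 := by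
      refine ((hd.div_const q).sub ((hasDerivAt_id (0 : ℝ)).mul_const (ℓ t))).congr_deriv ?_
      rw [one_mul]
    have hmin : IsLocalMin (fun s : ℝ => (∫ x, |f x + s * ι t x| ^ q ∂μ) / q - s * ℓ t) 0 := by
      refine Eventually.of_forall fun s => ?_
      have := hf (s • t)
      rw [map_smul, smul_eq_mul] at this
      have h0 := hF 0
      rw [zero_smul, map_zero, add_zero] at h0
      simp only [hF s, h0]
      linarith
    have h0 := hmin.hasDerivAt_eq_zero hd2
    simp only [mul_assoc, integral_const_mul] at h0 ⊢
    rw [mul_div_cancel_left₀ _ hq0.ne'] at h0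
    linarith

end LpDuality

/-! ### Translations in `L^p` and integrability along segments -/

section Translations

variable {E F : Type*} [NormedAddCommGroup E] [NormedSpace ℝ E] [FiniteDimensional ℝ E]
  [MeasurableSpace E] [BorelSpace E] [NormedAddCommGroup F]
  {μ : Measure E} [μ.IsAddHaarMeasure]

/-- Translations are continuous in `L^p`. -/
theorem eventually_lintegral_enorm_sub_translate_rpow_le {p : ℝ} (hp : 1 ≤ p) {g : E → F}
    (hg : MemLp g (ENNReal.ofReal p) μ) {η : ℝ≥0∞} (hη : 0 < η) :
    ∀ᶠ h in 𝓝 (0 : E), ∫⁻ x, ‖g (x - h) - g x‖ₑ ^ p ∂μ ≤ η := by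
  have hp0 : 0 < p := one_pos.trans_le hp
  have : Fact (1 ≤ ENNReal.ofReal p) := ⟨by simpa using hp⟩
  -- Currying makes `h ↦ (x ↦ x - h)` continuous for the compact-open topology, the form in which
  -- composition with measure preserving maps is continuous on `L^p`.
  let τ : C(E, C(E, E)) := (ContinuousMap.mk (fun z : E × E => z.2 - z.1) (by fun_prop)).curry
  have hmp : ∀ h, MeasurePreserving (τ h) μ μ := fun h => measurePreserving_sub_right μ h
  have h1 : Tendsto (fun h => Lp.compMeasurePreserving (τ h) (hmp h) (hg.toLp g)) (𝓝 0)
      (𝓝 (Lp.compMeasurePreserving (τ 0) (hmp 0) (hg.toLp g))) :=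
    Tendsto.compMeasurePreservingLp tendsto_const_nhds (τ.continuous.tendsto 0) hmp (hmp 0)
      ENNReal.ofReal_ne_top
  rw [Lp.tendsto_Lp_iff_tendsto_eLpNorm'] at h1
  have h2 : ∀ h, eLpNorm (⇑(Lp.compMeasurePreserving (τ h) (hmp h) (hg.toLp g)) -
      ⇑(Lp.compMeasurePreserving (τ 0) (hmp 0) (hg.toLp g))) (ENNReal.ofReal p) μ ^ p =
      ∫⁻ x, ‖g (x - h) - g x‖ₑ ^ p ∂μ := by
    intro h
    rw [eLpNorm_eq_lintegral_rpow_enorm_toReal (by simpa) ENNReal.ofReal_ne_top,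
      ENNReal.toReal_ofReal hp0.le, one_div, ENNReal.rpow_inv_rpow hp0.ne']
    refine lintegral_congr_ae ?_
    rw [Lp.toLp_compMeasurePreserving, Lp.toLp_compMeasurePreserving]
    filter_upwards [(hg.comp_measurePreserving (hmp h)).coeFn_toLp,
      (hg.comp_measurePreserving (hmp 0)).coeFn_toLp] with x h1 h2
    simp only [Pi.sub_apply, h1, h2, Function.comp]
    simp [τ]
  have h3 : Tendsto (fun h => ∫⁻ x, ‖g (x - h) - g x‖ₑ ^ p ∂μ) (𝓝 0) (𝓝 0) := by
    have := (ENNReal.continuous_rpow_const (y := p)).tendsto 0 |>.comp h1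
    rw [ENNReal.zero_rpow_of_pos hp0] at this
    exact this.congr h2
  filter_upwards [(tendsto_order.1 h3).2 η hη] with h hh using hh.le

/-- Jensen's inequality for `t ↦ t ^ p`, obtained from Hölder against the constant `1`. -/
theorem lintegral_rpow_le_lintegral_rpow {α : Type*} [MeasurableSpace α] {μ : Measure α}
    [IsProbabilityMeasure μ] {p : ℝ} (hp : 1 < p) {f : α → ℝ≥0∞} (hf : AEMeasurable f μ) :
    (∫⁻ x, f x ∂μ) ^ p ≤ ∫⁻ x, f x ^ p ∂μ := by
  have h := ENNReal.lintegral_mul_le_Lp_mul_Lq μ (Real.HolderConjugate.conjExponent hp) hf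
    (aemeasurable_const (b := 1))
  simp only [Pi.mul_apply, mul_one, ENNReal.one_rpow, lintegral_const, measure_univ] at h
  calc (∫⁻ x, f x ∂μ) ^ p ≤ ((∫⁻ x, f x ^ p ∂μ) ^ (1 / p)) ^ p :=
        ENNReal.rpow_le_rpow h (by linarith)
    _ = _ := by rw [one_div, ENNReal.rpow_inv_rpow (by linarith)]

/-- For `t ∈ [0,1]` the translates of the ball of radius `R` stay in the ball of radius `R + ‖h‖`,
where `g` is integrable; this bound is uniform in `t`. -/
theorem integrable_translate_prod {G : Type*} [NormedAddCommGroup G] [MeasurableSpace G]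
    [BorelSpace G] [SecondCountableTopology G] {τ : Measure ℝ} [IsFiniteMeasure τ]
    (hτ : ∀ᵐ t ∂τ, t ∈ Icc (0 : ℝ) 1) {g : E → G} (hgm : Measurable g)
    (hg : LocallyIntegrable g μ) (h : E) (R : ℝ) :
    Integrable (fun z : E × ℝ => g (z.1 - z.2 • h)) ((μ.restrict (Metric.closedBall 0 R)).prod τ) := by
  have hm : Measurable fun z : E × ℝ => g (z.1 - z.2 • h) := hgm.comp (by fun_prop)
  refine ⟨hm.aestronglyMeasurable, ?_⟩
  rw [hasFiniteIntegral_iff_enorm, lintegral_prod_symm' _ hm.enorm]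
  set B := ∫⁻ y in Metric.closedBall 0 (R + ‖h‖), ‖g y‖ₑ ∂μ with hB
  have hBfin : B < ⊤ := (hg.integrableOn_isCompact (isCompact_closedBall _ _)).hasFiniteIntegral
  refine lt_of_le_of_lt (lintegral_mono_ae (g := fun _ => B) ?_)
    (by rw [lintegral_const]; exact ENNReal.mul_lt_top hBfin (measure_lt_top _ _))
  filter_upwards [hτ] with t ht
  rw [hB, ← lintegral_indicator Metric.isClosed_closedBall.measurableSet,
    ← lintegral_indicator Metric.isClosed_closedBall.measurableSet,
    ← lintegral_sub_right_eq_self ((Metric.closedBall 0 (R + ‖h‖)).indicator fun y => ‖g y‖ₑ) (t • h)]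
  refine lintegral_mono fun x => ?_
  by_cases hx : x ∈ Metric.closedBall (0 : E) R
  · have hx' : x - t • h ∈ Metric.closedBall (0 : E) (R + ‖h‖) := by
      rw [mem_closedBall_zero_iff] at hx ⊢
      refine (norm_sub_le _ _).trans (add_le_add hx ?_)
      rw [norm_smul, Real.norm_eq_abs, abs_of_nonneg ht.1]
      exact mul_le_of_le_one_left (norm_nonneg _) ht.2
    simp [hx, hx']
  · rw [indicator_of_notMem hx]
    exact zero_le

theorem integrable_prod_of_forall_eq_zero {α β : Type*} [MeasurableSpace α] [MeasurableSpace β]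
    {μ : Measure α} {ν : Measure β} [SFinite μ] [SFinite ν] {s : Set α} {f : α × β → ℝ}
    (hf : Integrable f ((μ.restrict s).prod ν)) (h0 : ∀ z, z.1 ∉ s → f z = 0) :
    Integrable f (μ.prod ν) := by
  have h1 : (μ.restrict s).prod ν = (μ.prod ν).restrict (s ×ˢ univ) := by
    rw [← Measure.prod_restrict, Measure.restrict_univ]
  rw [h1] at hf
  refine (integrableOn_iff_integrable_of_support_subset fun z hz => ?_).1 hf
  by_contra hc
  exact hz (h0 z fun h => hc ⟨h, mem_univ _⟩)

end Translations

/-! ### Increments of Sobolev functions along segments -/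

section WeakGradientTranslate

variable {d : ℕ} {Ω : Set (EuclideanSpace ℝ (Fin d))} {u : EuclideanSpace ℝ (Fin d) → ℝ}
  {g : EuclideanSpace ℝ (Fin d) → EuclideanSpace ℝ (Fin d)}

theorem IsWeakGradient.integral_mul_fderiv (hu : IsWeakGradient Ω u g)
    {φ : EuclideanSpace ℝ (Fin d) → ℝ} (h1 : ContDiff ℝ ∞ φ) (h2 : HasCompactSupport φ)
    (h3 : tsupport φ ⊆ Ω) (v : EuclideanSpace ℝ (Fin d)) :
    ∫ x in Ω, u x * fderiv ℝ φ x v = - ∫ x in Ω, ⟪g x, v⟫_ℝ * φ x := by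
  have hv : v = ∑ i, v i • EuclideanSpace.single i (1 : ℝ) := by
    ext j
    simp [Pi.single_apply]
  have e1 : ∀ x, u x * fderiv ℝ φ x v =
      ∑ i, v i * (u x * fderiv ℝ φ x (EuclideanSpace.single i 1)) := by
    intro x
    conv_lhs => rw [hv]
    rw [map_sum, Finset.mul_sum]
    exact Finset.sum_congr rfl fun i _ => by rw [map_smul, smul_eq_mul]; ring
  have e2 : ∀ x, ⟪g x, v⟫_ℝ * φ x = ∑ i, v i * (g x i * φ x) := by
    intro x
    rw [PiLp.inner_apply, Finset.sum_mul]
    exact Finset.sum_congr rfl fun i _ => by simp; ring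
  simp only [e1, e2]
  rw [integral_finsetSum _ fun i _ => (hu.integrable_left h1 h2 h3 _).const_mul _,
    integral_finsetSum _ fun i _ => (hu.integrable_right h1 h2 h3 i).const_mul _,
    ← Finset.sum_neg_distrib]
  refine Finset.sum_congr rfl fun i _ => ?_
  rw [integral_const_mul, integral_const_mul, hu.integral_eq φ h1 h2 h3 i, mul_neg]

/-- The fundamental theorem of calculus along segments, tested against `φ`. -/
theorem IsWeakGradient.integral_mul_sub_translate (hu : IsWeakGradient univ u g)
    (hgm : Measurable g) {φ : EuclideanSpace ℝ (Fin d) → ℝ} (h1 : ContDiff ℝ ∞ φ)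
    (h2 : HasCompactSupport φ) (h : EuclideanSpace ℝ (Fin d)) :
    ∫ x, φ x * (u x - u (x - h)) =
      ∫ x, φ x * ∫ t in Icc (0 : ℝ) 1, ⟪g (x - t • h), h⟫_ℝ := by
  have hul : LocallyIntegrable u volume := locallyIntegrableOn_univ.1 hu.locallyIntegrableOn
  have hgl : LocallyIntegrable g volume := locallyIntegrableOn_univ.1 hu.locallyIntegrableOn_grad
  set τ := (volume : Measure ℝ).restrict (Icc 0 1) with hτ
  have hτm : ∀ᵐ t ∂τ, t ∈ Icc (0 : ℝ) 1 := ae_restrict_mem measurableSet_Icc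
  obtain ⟨R, hR⟩ := h2.isCompact.isBounded.subset_closedBall (0 : EuclideanSpace ℝ (Fin d))
  obtain ⟨C, hC⟩ := h2.exists_bound_of_continuous h1.continuous
  have hφ0 : ∀ x, x ∉ Metric.closedBall (0 : EuclideanSpace ℝ (Fin d)) R → φ x = 0 :=
    fun x hx => image_eq_zero_of_notMem_tsupport fun hx' => hx (hR hx')
  have hdc : Continuous (fderiv ℝ φ) := h1.continuous_fderiv (by simp)
  have hds : HasCompactSupport (fderiv ℝ φ) := h2.fderiv ℝ
  obtain ⟨C', hC'⟩ := hds.exists_bound_of_continuous hdc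
  have hd0 : ∀ x, x ∉ Metric.closedBall (0 : EuclideanSpace ℝ (Fin d)) R → fderiv ℝ φ x = 0 :=
    fun x hx => image_eq_zero_of_notMem_tsupport fun hx' =>
      hx (hR (tsupport_fderiv_subset ℝ hx'))
  -- integrability of the two integrands on the product space
  have hI1 : Integrable (Function.uncurry fun (x : EuclideanSpace ℝ (Fin d)) (t : ℝ) =>
      φ x * ⟪g (x - t • h), h⟫_ℝ) (volume.prod τ) := by
    refine integrable_prod_of_forall_eq_zero (s := Metric.closedBall 0 R) ?_
      fun z hz => by simp [Function.uncurry, hφ0 _ hz]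
    refine Integrable.bdd_mul (c := C) ((integrable_translate_prod hτm hgm hgl h R).inner_const h)
      (h1.continuous.comp continuous_fst).aestronglyMeasurable
      (Eventually.of_forall fun z => hC z.1)
  -- For all `t ∈ [0,1]` the integrand vanishes for `y` outside one ball, of radius `R + ‖h‖`, so
  -- local integrability of `u` is enough.
  have hI2 : Integrable (Function.uncurry fun (y : EuclideanSpace ℝ (Fin d)) (t : ℝ) =>
      u y * fderiv ℝ φ (y + t • h) h) (volume.prod τ) := by
    have hcont : Continuous fun z : EuclideanSpace ℝ (Fin d) × ℝ => fderiv ℝ φ (z.1 + z.2 • h) h :=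
      (hdc.comp (by fun_prop)).clm_apply continuous_const
    have hui : Integrable (fun z : EuclideanSpace ℝ (Fin d) × ℝ => u z.1 * 1)
        ((volume.restrict (Metric.closedBall 0 (R + ‖h‖))).prod τ) :=
      (hul.integrableOn_isCompact (isCompact_closedBall _ _)).mul_prod (integrable_const 1)
    simp only [mul_one] at hui
    have := hui.mul_bdd (c := C' * ‖h‖) hcont.aestronglyMeasurable (Eventually.of_forall fun z =>
      (ContinuousLinearMap.le_opNorm _ _).trans
        (mul_le_mul_of_nonneg_right (hC' _) (norm_nonneg _)))
    have h3 : (volume : Measure (EuclideanSpace ℝ (Fin d))).prod τ =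
        ((volume : Measure (EuclideanSpace ℝ (Fin d))).prod volume).restrict (univ ×ˢ Icc 0 1) := by
      rw [← Measure.prod_restrict, Measure.restrict_univ]
    have h4 : (volume.restrict (Metric.closedBall 0 (R + ‖h‖))).prod τ =
        ((volume : Measure (EuclideanSpace ℝ (Fin d))).prod τ).restrict
          (Metric.closedBall 0 (R + ‖h‖) ×ˢ univ) := by
      rw [← Measure.prod_restrict, Measure.restrict_univ]
    rw [h4] at this
    refine (integrable_indicator_iff (Metric.isClosed_closedBall.measurableSet.prod
      MeasurableSet.univ)).2 this |>.congr ?_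
    have hmem : ∀ᵐ z ∂((volume : Measure (EuclideanSpace ℝ (Fin d))).prod τ), z.2 ∈ Icc (0 : ℝ) 1 := by
      rw [h3]
      filter_upwards [ae_restrict_mem (MeasurableSet.univ.prod measurableSet_Icc)] with z hz
      exact hz.2
    filter_upwards [hmem] with z hz
    by_cases hz1 : z.1 ∈ Metric.closedBall (0 : EuclideanSpace ℝ (Fin d)) (R + ‖h‖)
    · rw [indicator_of_mem (by exact ⟨hz1, mem_univ _⟩)]; rfl
    · rw [indicator_of_notMem (fun hc => hz1 hc.1)]
      have : fderiv ℝ φ (z.1 + z.2 • h) = 0 := by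
        refine hd0 _ fun hc => hz1 ?_
        rw [mem_closedBall_zero_iff] at hc ⊢
        calc ‖z.1‖ = ‖(z.1 + z.2 • h) - z.2 • h‖ := by simp
          _ ≤ R + ‖h‖ := by
            refine (norm_sub_le _ _).trans (add_le_add hc ?_)
            rw [norm_smul, Real.norm_eq_abs, abs_of_nonneg hz.1]
            exact mul_le_of_le_one_left (norm_nonneg _) hz.2
      simp [Function.uncurry, this]
  have hshift : ∀ k : EuclideanSpace ℝ (Fin d), ContDiff ℝ ∞ (fun y => φ (y + k)) ∧
      HasCompactSupport (fun y => φ (y + k)) := fun k =>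
    ⟨h1.comp (contDiff_id.add contDiff_const),
      h2.comp_homeomorph (Homeomorph.addRight k)⟩
  have hR1 : ∫ x, φ x * ∫ t in Icc (0 : ℝ) 1, ⟪g (x - t • h), h⟫_ℝ =
      ∫ t, ∫ x, φ x * ⟪g (x - t • h), h⟫_ℝ ∂volume ∂τ := by
    rw [← integral_integral_swap hI1]
    exact integral_congr_ae (Eventually.of_forall fun x => (integral_const_mul _ _).symm)
  -- After a change of variables the translate `φ (· + t • h)` is itself a test function, so the
  -- weak gradient identity applies for each `t`. The `t`-integral then falls on the smooth `φ`,
  -- where the classical fundamental theorem of calculus holds.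
  have hR2 : ∀ t : ℝ, ∫ x, φ x * ⟪g (x - t • h), h⟫_ℝ = - ∫ y, u y * fderiv ℝ φ (y + t • h) h := by
    intro t
    have h3 := hu.integral_mul_fderiv (hshift (t • h)).1 (hshift (t • h)).2 (subset_univ _) h
    simp only [Measure.restrict_univ, fderiv_comp_add_right] at h3
    rw [h3, neg_neg, ← integral_sub_right_eq_self (fun y => ⟪g y, h⟫_ℝ * φ (y + t • h)) (t • h)]
    exact integral_congr_ae (Eventually.of_forall fun x => by simp [mul_comm])
  have hR3 : ∀ y, ∫ t, u y * fderiv ℝ φ (y + t • h) h ∂τ =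
      u y * (φ (y + h) - φ y) := by
    intro y
    rw [integral_const_mul, hτ, integral_Icc_eq_integral_Ioc,
      ← intervalIntegral.integral_of_le zero_le_one,
      intervalIntegral.integral_eq_sub_of_hasDerivAt (f := fun t => φ (y + t • h))]
    · simp
    · intro t _
      have h3 : HasDerivAt (fun t : ℝ => y + t • h) h t := by
        simpa using ((hasDerivAt_id t).smul_const h).const_add y
      exact ((h1.differentiable (by simp)) (y + t • h)).hasFDerivAt.comp_hasDerivAt t h3
    · exact ((hdc.comp (by fun_prop)).clm_apply continuous_const).intervalIntegrable _ _
  rw [hR1]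
  simp only [hR2]
  rw [integral_neg, ← integral_integral_swap hI2]
  simp only [hR3]
  have hi1 : Integrable (fun y => u y * φ y) volume := by
    have := integrableOn_mul_of_tsupport_subset hu.locallyIntegrableOn h1.continuous h2
      (subset_univ _)
    rwa [integrableOn_univ] at this
  have hi2 : Integrable (fun y => u y * φ (y + h)) volume := by
    have := integrableOn_mul_of_tsupport_subset hu.locallyIntegrableOn (hshift h).1.continuous
      (hshift h).2 (subset_univ _)
    rwa [integrableOn_univ] at this
  have hi3 : Integrable (fun x => φ x * u (x - h)) volume := by
    refine (hi2.comp_sub_right h).congr (Eventually.of_forall fun x => ?_)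
    simp [mul_comm]
  have e3 : ∫ x, φ x * u (x - h) = ∫ y, u y * φ (y + h) := by
    rw [← integral_sub_right_eq_self (fun y => u y * φ (y + h)) h]
    exact integral_congr_ae (Eventually.of_forall fun x => by simp [mul_comm])
  simp only [mul_sub]
  rw [integral_sub (by simpa only [mul_comm] using hi1) hi3, integral_sub hi2 hi1, e3]
  simp only [mul_comm (φ _)]
  ring

/-- Two locally integrable functions with the same integrals against all test functions agree almost
everywhere. Integrability in `t` is recorded because the Bochner integral must later be split. -/
theorem IsWeakGradient.ae_sub_translate_eq (hu : IsWeakGradient univ u g)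
    (hgm : Measurable g) (h : EuclideanSpace ℝ (Fin d)) :
    ∀ᵐ x, Integrable (fun t : ℝ => ⟪g (x - t • h), h⟫_ℝ) (volume.restrict (Icc 0 1)) ∧
      u x - u (x - h) = ∫ t in Icc (0 : ℝ) 1, ⟪g (x - t • h), h⟫_ℝ := by
  have hul : LocallyIntegrable u volume := locallyIntegrableOn_univ.1 hu.locallyIntegrableOn
  have hgl : LocallyIntegrable g volume := locallyIntegrableOn_univ.1 hu.locallyIntegrableOn_grad
  set τ := (volume : Measure ℝ).restrict (Icc 0 1) with hτ
  have hτm : ∀ᵐ t ∂τ, t ∈ Icc (0 : ℝ) 1 := ae_restrict_mem measurableSet_Icc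
  have hI : ∀ R : ℝ, Integrable (fun z : EuclideanSpace ℝ (Fin d) × ℝ => ⟪g (z.1 - z.2 • h), h⟫_ℝ)
      ((volume.restrict (Metric.closedBall 0 R)).prod τ) := fun R =>
    (integrable_translate_prod hτm hgm hgl h R).inner_const h
  have hcover : ∀ P : EuclideanSpace ℝ (Fin d) → Prop,
      (∀ n : ℕ, ∀ᵐ x ∂(volume.restrict (Metric.closedBall 0 (n : ℝ))), P x) → ∀ᵐ x, P x := by
    intro P hP
    rw [← Measure.restrict_univ (μ := volume),
      ← Metric.iUnion_closedBall_nat (0 : EuclideanSpace ℝ (Fin d)), ae_restrict_iUnion_iff]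
    exact hP
  refine (hcover _ fun n => (hI n).prod_right_ae).and ?_
  have hloc : ∀ f : EuclideanSpace ℝ (Fin d) → ℝ,
      (∀ R : ℝ, IntegrableOn f (Metric.closedBall 0 R) volume) → LocallyIntegrable f volume := by
    intro f hf x
    refine ⟨Metric.closedBall 0 (‖x‖ + 1), ?_, hf _⟩
    exact mem_of_superset (Metric.isOpen_ball.mem_nhds (by simp : x ∈ Metric.ball 0 (‖x‖ + 1)))
      Metric.ball_subset_closedBall
  refine ae_eq_of_integral_contDiff_smul_eq (hul.sub (hloc _ fun R => ?_)) (hloc _ fun R =>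
    (hI R).integral_prod_left) fun φ h1 h2 => hu.integral_mul_sub_translate hgm h1 h2 h
  have h3 := ((integrable_indicator_iff Metric.isClosed_closedBall.measurableSet).2
    (hul.integrableOn_isCompact (isCompact_closedBall 0 (R + ‖h‖)))).comp_sub_right h
  refine (h3.integrableOn (s := Metric.closedBall 0 R)).congr_fun (fun x hx => ?_)
    Metric.isClosed_closedBall.measurableSet
  refine indicator_of_mem ?_ _
  rw [mem_closedBall_zero_iff] at hx ⊢
  exact (norm_sub_le _ _).trans (add_le_add_left hx _)

end WeakGradientTranslate

theorem enorm_real_inner_le {E : Type*} [SeminormedAddCommGroup E] [InnerProductSpace ℝ E]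
    (x y : E) : ‖⟪x, y⟫_ℝ‖ₑ ≤ ‖x‖ₑ * ‖y‖ₑ := by
  rw [← ofReal_norm, ← ofReal_norm, ← ofReal_norm, ← ENNReal.ofReal_mul (norm_nonneg _)]
  exact ENNReal.ofReal_le_ofReal (norm_inner_le_norm _ _)

section WeakGradientTranslate

variable {d : ℕ} {Ω : Set (EuclideanSpace ℝ (Fin d))} {u : EuclideanSpace ℝ (Fin d) → ℝ}
  {g : EuclideanSpace ℝ (Fin d) → EuclideanSpace ℝ (Fin d)}

/-- The remainder is `∫₀¹ (g (x - th) - g x) · h dt`; Jensen in `t` and Tonelli reduce it to the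
modulus of continuity of translations of `g`. -/
theorem IsWeakGradient.lintegral_sub_translate_sub_inner_le {p : ℝ} (hp : 1 < p)
    (hu : IsWeakGradient univ u g) (hgm : Measurable g) (h : EuclideanSpace ℝ (Fin d)) {W : ℝ≥0∞}
    (hW : ∀ t ∈ Icc (0 : ℝ) 1, ∫⁻ x, ‖g (x - t • h) - g x‖ₑ ^ p ≤ W) :
    ∫⁻ x, ‖u x - u (x - h) - ⟪g x, h⟫_ℝ‖ₑ ^ p ≤ ‖h‖ₑ ^ p * W := by
  have hp0 : 0 < p := one_pos.trans hp
  set τ := (volume : Measure ℝ).restrict (Icc 0 1) with hτ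
  have hτp : IsProbabilityMeasure τ := ⟨by simp [hτ]⟩
  have hm : Measurable fun z : EuclideanSpace ℝ (Fin d) × ℝ => ‖g (z.1 - z.2 • h) - g z.1‖ₑ :=
    ((hgm.comp (by fun_prop)).sub (hgm.comp measurable_fst)).enorm
  calc ∫⁻ x, ‖u x - u (x - h) - ⟪g x, h⟫_ℝ‖ₑ ^ p
      ≤ ∫⁻ x, ‖h‖ₑ ^ p * ∫⁻ t, ‖g (x - t • h) - g x‖ₑ ^ p ∂τ := by
        apply lintegral_mono_ae
        filter_upwards [hu.ae_sub_translate_eq hgm h] with x hx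
        have hmx : Measurable fun t : ℝ => ‖g (x - t • h) - g x‖ₑ :=
          ((hgm.comp (by fun_prop)).sub measurable_const).enorm
        have e1 : u x - u (x - h) - ⟪g x, h⟫_ℝ = ∫ t, ⟪g (x - t • h) - g x, h⟫_ℝ ∂τ := by
          simp only [inner_sub_left]
          rw [integral_sub hx.1 (integrable_const _), hx.2]
          simp
        rw [e1]
        calc ‖∫ t, ⟪g (x - t • h) - g x, h⟫_ℝ ∂τ‖ₑ ^ p
            ≤ (∫⁻ t, ‖h‖ₑ * ‖g (x - t • h) - g x‖ₑ ∂τ) ^ p := by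
              have h1 : ∫⁻ t, ‖⟪g (x - t • h) - g x, h⟫_ℝ‖ₑ ∂τ ≤
                  ∫⁻ t, ‖h‖ₑ * ‖g (x - t • h) - g x‖ₑ ∂τ := by
                gcongr with t
                rw [mul_comm]
                exact enorm_real_inner_le _ _
              gcongr
              exact (enorm_integral_le_lintegral_enorm _).trans h1
          _ ≤ _ := by
              rw [lintegral_const_mul _ hmx, ENNReal.mul_rpow_of_nonneg _ _ hp0.le]
              gcongr
              exact lintegral_rpow_le_lintegral_rpow hp hmx.aemeasurable
    _ = ‖h‖ₑ ^ p * ∫⁻ t, ∫⁻ x, ‖g (x - t • h) - g x‖ₑ ^ p ∂volume ∂τ := by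
        rw [lintegral_const_mul' _ _ (ENNReal.rpow_ne_top_of_nonneg hp0.le enorm_ne_top),
          lintegral_lintegral_swap (hm.pow_const p).aemeasurable]
    _ ≤ ‖h‖ₑ ^ p * W := by
        gcongr
        refine (lintegral_mono_ae (g := fun _ => W) ?_).trans (by simp)
        filter_upwards [ae_restrict_mem measurableSet_Icc] with t ht using hW t ht

end WeakGradientTranslate

/-! ### Stability of `p`-th powers and `p`-energies -/

section Perturbation

theorem ENNReal.exists_rpow_le_rpow_add_of_le_add {p : ℝ} (hp : 0 < p) {C η : ℝ≥0∞} (hC : C ≠ ⊤)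
    (hη : 0 < η) : ∃ δ : ℝ≥0∞, 0 < δ ∧ ∀ b x : ℝ≥0∞, b ≤ C → x ≤ b + δ → x ^ p ≤ b ^ p + η := by
  lift C to ℝ≥0 using hC
  obtain ⟨η', hη', hη'η⟩ := ENNReal.lt_iff_exists_nnreal_btwn.1 hη
  have hη'0 : 0 < (η' : ℝ) := by exact_mod_cast hη'
  have hu := (isCompact_Icc (a := (0 : ℝ)) (b := C + 1)).uniformContinuousOn_of_continuous
    (f := fun x : ℝ => x ^ p) (Real.continuous_rpow_const hp.le).continuousOn
  obtain ⟨δ, hδ, h⟩ := Metric.uniformContinuousOn_iff.1 hu η' hη'0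
  -- The cap at `1` keeps `b + δ'` inside `[0, C + 1]`, where `x ↦ x ^ p` is uniformly continuous.
  set δ' : ℝ≥0 := ⟨min (δ / 2) 1, by positivity⟩ with hδ'
  have hδ'1 : (δ' : ℝ) ≤ 1 := min_le_right _ _
  have hδ'2 : (δ' : ℝ) < δ := (min_le_left _ _).trans_lt (by linarith)
  have hδ'0 : 0 < δ' := by
    rw [← NNReal.coe_pos]; exact lt_min (by positivity) one_pos
  refine ⟨δ', by exact_mod_cast hδ'0, fun b x hb hx => ?_⟩
  lift b to ℝ≥0 using ne_top_of_le_ne_top ENNReal.coe_ne_top hb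
  have hb' : (b : ℝ) ≤ C := by exact_mod_cast hb
  calc x ^ p ≤ ((b : ℝ≥0∞) + δ') ^ p := ENNReal.rpow_le_rpow hx hp.le
    _ ≤ (b : ℝ≥0∞) ^ p + η' := by
      rw [← ENNReal.coe_add, ← ENNReal.coe_rpow_of_nonneg _ hp.le,
        ← ENNReal.coe_rpow_of_nonneg _ hp.le, ← ENNReal.coe_add, ENNReal.coe_le_coe,
        ← NNReal.coe_le_coe]
      push_cast
      have := h (b + δ') ⟨by positivity, by linarith⟩ b ⟨by positivity, by linarith⟩
        (by simpa [Real.dist_eq] using hδ'2)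
      rw [Real.dist_eq] at this
      linarith [(abs_lt.1 this).2]
    _ ≤ _ := by gcongr

/-- Replacing `b` by `min b C` reduces to the previous case. Here only the smaller quantity `x` is
bounded a priori, which is what the converse direction offers. -/
theorem ENNReal.exists_rpow_le_rpow_add_of_le {p : ℝ} (hp : 0 < p) {C η : ℝ≥0∞} (hC : C ≠ ⊤)
    (hη : 0 < η) : ∃ δ : ℝ≥0∞, 0 < δ ∧ ∀ b x : ℝ≥0∞, x ≤ C → x ≤ b + δ → x ^ p ≤ b ^ p + η := by
  obtain ⟨δ, hδ, h⟩ := ENNReal.exists_rpow_le_rpow_add_of_le_add hp hC hη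
  refine ⟨δ, hδ, fun b x hx hxb => ?_⟩
  have h1 : x ≤ min b C + δ := by
    rw [min_add]
    exact le_min hxb (hx.trans le_self_add)
  refine (h _ _ (min_le_right b C) h1).trans ?_
  gcongr
  exact min_le_left _ _

/-- Minkowski's inequality combined with uniform continuity of the `p`-th power. The same `δ` serves
all measures and functions because both the domain of integration and the integrands vary with `h`.
-/
theorem exists_lintegral_rpow_le_add {α : Type*} [MeasurableSpace α] {p : ℝ} (hp : 1 < p)
    {C η : ℝ≥0∞} (hC : C ≠ ⊤) (hη : 0 < η) :
    ∃ δ : ℝ≥0∞, 0 < δ ∧ ∀ (μ : Measure α) (f g : α → ℝ), Measurable f → Measurable g →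
      ∫⁻ x, ‖f x - g x‖ₑ ^ p ∂μ ≤ δ → ∫⁻ x, ‖g x‖ₑ ^ p ∂μ ≤ C →
      ∫⁻ x, ‖f x‖ₑ ^ p ∂μ ≤ ∫⁻ x, ‖g x‖ₑ ^ p ∂μ + η := by
  have hp0 : 0 < p := one_pos.trans hp
  obtain ⟨δ, hδ, h⟩ := ENNReal.exists_rpow_le_rpow_add_of_le_add hp0
    (ENNReal.rpow_ne_top_of_nonneg (y := 1 / p) (by positivity) hC) hη
  refine ⟨δ ^ p, ENNReal.rpow_pos_of_nonneg hδ hp0.le, fun μ f g hf hg hfg hgC => ?_⟩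
  have h1 := h ((∫⁻ x, ‖g x‖ₑ ^ p ∂μ) ^ (1 / p)) ((∫⁻ x, ‖f x‖ₑ ^ p ∂μ) ^ (1 / p))
    (by gcongr) ?_
  · rwa [one_div, ENNReal.rpow_inv_rpow hp0.ne', ENNReal.rpow_inv_rpow hp0.ne'] at h1
  · have h2 : (∫⁻ x, ‖f x - g x‖ₑ ^ p ∂μ) ^ (1 / p) ≤ δ := by
      rw [one_div]
      exact (ENNReal.rpow_inv_le_iff hp0).2 hfg
    refine le_trans ?_ (add_le_add_right h2 _)
    refine le_trans ?_ (ENNReal.lintegral_Lp_add_le (f := fun x => ‖g x‖ₑ)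
      (g := fun x => ‖f x - g x‖ₑ) (by fun_prop) (by fun_prop) hp.le)
    gcongr with x
    simp only [Pi.add_apply]
    calc ‖f x‖ₑ = ‖g x + (f x - g x)‖ₑ := by rw [add_sub_cancel]
      _ ≤ _ := enorm_add_le _ _

end Perturbation

/-! ### Limit of the energies for Sobolev functions -/

section LimitOfEnergies

variable {d : ℕ} {Ω : Set (EuclideanSpace ℝ (Fin d))} {u : EuclideanSpace ℝ (Fin d) → ℝ}
  {g : EuclideanSpace ℝ (Fin d) → EuclideanSpace ℝ (Fin d)} {p : ℝ}

theorem MeasureTheory.MemLp.lintegral_enorm_rpow_lt_top {α F : Type*} [MeasurableSpace α]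
    [NormedAddCommGroup F] {μ : Measure α} {f : α → F} {p : ℝ} (hp : 0 < p)
    (hf : MemLp f (ENNReal.ofReal p) μ) : ∫⁻ x, ‖f x‖ₑ ^ p ∂μ < ⊤ := by
  have := lintegral_rpow_enorm_lt_top_of_eLpNorm_lt_top (by simpa) ENNReal.ofReal_ne_top hf.2
  rwa [ENNReal.toReal_ofReal hp.le] at this

theorem lintegral_enorm_inner_unit_rpow_le (hp : 0 < p) (S : Set (EuclideanSpace ℝ (Fin d)))
    (h : EuclideanSpace ℝ (Fin d)) :
    ∫⁻ x in S, ‖⟪g x, ‖h‖⁻¹ • h⟫_ℝ‖ₑ ^ p ≤ ∫⁻ x in S, ‖g x‖ₑ ^ p := by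
  gcongr with x
  refine (enorm_real_inner_le _ _).trans (mul_le_of_le_one_right' ?_)
  rw [← ofReal_norm, ENNReal.ofReal_le_one, norm_smul, norm_inv, norm_norm]
  exact inv_mul_le_one

theorem diffQuotient_eq_lintegral (hp : 0 < p) {h : EuclideanSpace ℝ (Fin d)} (h0 : h ≠ 0)
    (h1 : ‖h‖ ≤ 1) : diffQuotient Ω p u h =
      ∫⁻ x in Ω ∩ {x | x - h ∈ Ω}, ‖‖h‖⁻¹ * (u x - u (x - h))‖ₑ ^ p := by
  have hn : 0 < ‖h‖ := norm_pos_iff.2 h0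
  rw [diffQuotient, min_eq_right (Real.rpow_le_one hn.le h1 hp.le), div_eq_mul_inv, mul_comm,
    ← lintegral_const_mul']
  · refine lintegral_congr fun x => ?_
    rw [enorm_mul, ENNReal.mul_rpow_of_nonneg _ _ hp.le, enorm_inv hn.ne', enorm_norm,
      ENNReal.inv_rpow, ← ENNReal.ofReal_rpow_of_nonneg hn.le hp.le, ofReal_norm]
  · simpa using Real.rpow_pos_of_pos hn p

theorem lintegral_difference_quotient_sub_inner_le (hp : 1 < p)
    (hu : IsWeakGradient univ u g) (hgm : Measurable g) {h : EuclideanSpace ℝ (Fin d)}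
    (h0 : h ≠ 0) {W : ℝ≥0∞} (hW : ∀ t ∈ Icc (0 : ℝ) 1, ∫⁻ x, ‖g (x - t • h) - g x‖ₑ ^ p ≤ W) :
    ∫⁻ x, ‖‖h‖⁻¹ * (u x - u (x - h)) - ⟪g x, ‖h‖⁻¹ • h⟫_ℝ‖ₑ ^ p ≤ W := by
  have hp0 : 0 < p := one_pos.trans hp
  have hn : 0 < ‖h‖ := norm_pos_iff.2 h0
  have h1 := hu.lintegral_sub_translate_sub_inner_le hp hgm h hW
  have e1 : ∀ x, ‖‖h‖⁻¹ * (u x - u (x - h)) - ⟪g x, ‖h‖⁻¹ • h⟫_ℝ‖ₑ ^ p =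
      (‖h‖ₑ ^ p)⁻¹ * ‖u x - u (x - h) - ⟪g x, h⟫_ℝ‖ₑ ^ p := by
    intro x
    rw [inner_smul_right, ← mul_sub, enorm_mul, ENNReal.mul_rpow_of_nonneg _ _ hp0.le,
      enorm_inv hn.ne', enorm_norm, ENNReal.inv_rpow]
  have hh0 : ‖h‖ₑ ^ p ≠ 0 := by simp [h0, hp0]
  have hht : ‖h‖ₑ ^ p ≠ ⊤ := ENNReal.rpow_ne_top_of_nonneg hp0.le enorm_ne_top
  simp only [e1]
  rw [lintegral_const_mul' _ _ (ENNReal.inv_ne_top.2 hh0)]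
  calc (‖h‖ₑ ^ p)⁻¹ * ∫⁻ x, ‖u x - u (x - h) - ⟪g x, h⟫_ℝ‖ₑ ^ p
      ≤ (‖h‖ₑ ^ p)⁻¹ * (‖h‖ₑ ^ p * W) := by gcongr
    _ = W := by rw [← mul_assoc, ENNReal.inv_mul_cancel hh0 hht, one_mul]

theorem eventually_lintegral_difference_quotient_sub_inner_le (hp : 1 < p)
    (hu : IsWeakGradient univ u g) (hgm : Measurable g)
    (hg : MemLp g (ENNReal.ofReal p) volume) {W : ℝ≥0∞} (hW : 0 < W) :
    ∀ᶠ h in 𝓝[≠] (0 : EuclideanSpace ℝ (Fin d)),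
      ∫⁻ x, ‖‖h‖⁻¹ * (u x - u (x - h)) - ⟪g x, ‖h‖⁻¹ • h⟫_ℝ‖ₑ ^ p ≤ W := by
  obtain ⟨r, hr, h1⟩ := Metric.eventually_nhds_iff.1
    (eventually_lintegral_enorm_sub_translate_rpow_le hp.le hg hW)
  filter_upwards [self_mem_nhdsWithin, nhdsWithin_le_nhds (Metric.ball_mem_nhds 0 hr)] with h h0 hh
  refine lintegral_difference_quotient_sub_inner_le hp hu hgm h0 fun t ht => h1 ?_
  rw [dist_zero_right, norm_smul, Real.norm_eq_abs, abs_of_nonneg ht.1]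
  exact (mul_le_of_le_one_left (norm_nonneg _) ht.2).trans_lt (mem_ball_zero_iff.1 hh)

/-- Dominated convergence: as `Ω` is open, each of its points satisfies `x - h ∈ Ω` for all small
`h`. This controls the part of `Ω` not seen by the difference quotient. -/
theorem tendsto_setLIntegral_diff_translate (hΩ : IsOpen Ω) (hgm : Measurable g) (hp : 0 < p)
    (hg : MemLp g (ENNReal.ofReal p) volume) :
    Tendsto (fun h => ∫⁻ x in Ω \ {x | x - h ∈ Ω}, ‖g x‖ₑ ^ p) (𝓝 0) (𝓝 0) := by
  have hm : ∀ h : EuclideanSpace ℝ (Fin d), MeasurableSet (Ω \ {x | x - h ∈ Ω}) := fun h =>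
    hΩ.measurableSet.diff (hΩ.preimage (by fun_prop)).measurableSet
  have h1 : Tendsto (fun h => ∫⁻ x, (Ω \ {x | x - h ∈ Ω}).indicator (fun x => ‖g x‖ₑ ^ p) x)
      (𝓝 0) (𝓝 (∫⁻ _ : EuclideanSpace ℝ (Fin d), 0)) := by
    refine tendsto_lintegral_filter_of_dominated_convergence (fun x => ‖g x‖ₑ ^ p)
      (Eventually.of_forall fun h => Measurable.indicator (by fun_prop) (hm h))
      (Eventually.of_forall fun h => Eventually.of_forall fun x => indicator_le_self _ _ x)
      (hg.lintegral_enorm_rpow_lt_top hp).ne (Eventually.of_forall fun x => ?_)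
    by_cases hx : x ∈ Ω
    · refine tendsto_const_nhds.congr' ?_
      have hc : ContinuousAt (fun h : EuclideanSpace ℝ (Fin d) => x - h) 0 := by fun_prop
      have : ∀ᶠ h in 𝓝 (0 : EuclideanSpace ℝ (Fin d)), x - h ∈ Ω :=
        hc (by simpa using hΩ.mem_nhds hx)
      filter_upwards [this] with h hh
      rw [indicator_of_notMem fun hc => hc.2 hh]
    · simp [hx]
  rw [lintegral_zero] at h1
  exact h1.congr fun h => lintegral_indicator (hm h) _

theorem lintegral_enorm_sub_translate_rpow_le (hp : 1 < p) (hum : Measurable u)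
    (h : EuclideanSpace ℝ (Fin d)) (S : Set (EuclideanSpace ℝ (Fin d))) :
    ∫⁻ x in S, ‖u x - u (x - h)‖ₑ ^ p ≤ 2 ^ p * ∫⁻ x, ‖u x‖ₑ ^ p := by
  have hp0 : 0 < p := one_pos.trans hp
  calc ∫⁻ x in S, ‖u x - u (x - h)‖ₑ ^ p
      ≤ ∫⁻ x, ‖u x - u (x - h)‖ₑ ^ p := setLIntegral_le_lintegral _ _
    _ ≤ ∫⁻ x, 2 ^ (p - 1) * (‖u x‖ₑ ^ p + ‖u (x - h)‖ₑ ^ p) := by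
        gcongr with x
        refine (ENNReal.rpow_le_rpow enorm_sub_le hp0.le).trans ?_
        exact ENNReal.rpow_add_le_mul_rpow_add_rpow _ _ hp.le
    _ = 2 ^ p * ∫⁻ x, ‖u x‖ₑ ^ p := by
        rw [lintegral_const_mul _ (by fun_prop), lintegral_add_left (by fun_prop),
          lintegral_sub_right_eq_self (fun x => ‖u x‖ₑ ^ p), ← two_mul, ← mul_assoc]
        congr 1
        conv_rhs => rw [show p = (p - 1) + 1 by ring,
          ENNReal.rpow_add _ _ two_ne_zero ENNReal.ofNat_ne_top, ENNReal.rpow_one]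

theorem eventually_diffQuotient_le_add (hp : 1 < p) (hum : Measurable u)
    (hu : IsWeakGradient univ u g) (hgm : Measurable g)
    (hg : MemLp g (ENNReal.ofReal p) volume) {η : ℝ≥0∞} (hη : 0 < η) :
    ∀ᶠ h in 𝓝[≠] (0 : EuclideanSpace ℝ (Fin d)),
      diffQuotient Ω p u h ≤ (∫⁻ x in Ω, ‖⟪g x, ‖h‖⁻¹ • h⟫_ℝ‖ₑ ^ p) + η := by
  have hp0 : 0 < p := one_pos.trans hp
  obtain ⟨δ, hδ, hpert⟩ := exists_lintegral_rpow_le_add (α := EuclideanSpace ℝ (Fin d)) hp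
    (hg.lintegral_enorm_rpow_lt_top hp0).ne hη
  filter_upwards [eventually_lintegral_difference_quotient_sub_inner_le hp hu hgm hg hδ,
    self_mem_nhdsWithin, nhdsWithin_le_nhds (Metric.closedBall_mem_nhds 0 one_pos)] with h hq h0 h1
  rw [diffQuotient_eq_lintegral hp0 h0 (mem_closedBall_zero_iff.1 h1)]
  refine (hpert _ _ _ (by fun_prop) (by fun_prop) ((setLIntegral_le_lintegral _ _).trans hq)
    ((lintegral_enorm_inner_unit_rpow_le hp0 _ h).trans (setLIntegral_le_lintegral _ _))).trans ?_
  gcongr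
  exact inter_subset_left

theorem exists_forall_diffQuotient_le (hp : 1 < p) (hum : Measurable u)
    (hup : MemLp u (ENNReal.ofReal p) volume) (hu : IsWeakGradient univ u g) (hgm : Measurable g)
    (hg : MemLp g (ENNReal.ofReal p) volume) :
    ∃ C : ℝ≥0∞, C ≠ ⊤ ∧ ∀ h ≠ 0, diffQuotient Ω p u h ≤ C := by
  have hp0 : 0 < p := one_pos.trans hp
  have hU := (hup.lintegral_enorm_rpow_lt_top hp0).ne
  have hG := (hg.lintegral_enorm_rpow_lt_top hp0).ne
  obtain ⟨r, hr, h1⟩ := Metric.mem_nhdsWithin_iff.1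
    (eventually_diffQuotient_le_add (Ω := Ω) hp hum hu hgm hg one_pos)
  -- Two regimes: near the origin the asymptotic bound with error `1`; for `‖h‖ ≥ r` the crude bound
  -- by the `L^p` norm of `u`, the denominator being bounded below there.
  refine ⟨max ((∫⁻ x, ‖g x‖ₑ ^ p) + 1)
    ((2 ^ p * ∫⁻ x, ‖u x‖ₑ ^ p) / ENNReal.ofReal (min 1 (r ^ p))), ?_, fun h h0 => ?_⟩
  · refine (max_lt (ENNReal.add_lt_top.2 ⟨hG.lt_top, ENNReal.one_lt_top⟩) ?_).ne
    refine ENNReal.div_lt_top (ENNReal.mul_ne_top (by finiteness) hU) ?_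
    simpa using Real.rpow_pos_of_pos hr p
  · by_cases hh : ‖h‖ < r
    · refine le_max_of_le_left ((h1 ⟨mem_ball_zero_iff.2 hh, h0⟩).trans ?_)
      exact add_le_add_left ((lintegral_enorm_inner_unit_rpow_le hp0 _ h).trans
        (setLIntegral_le_lintegral _ _)) _
    · refine le_max_of_le_right ?_
      rw [diffQuotient]
      gcongr
      · exact lintegral_enorm_sub_translate_rpow_le hp hum h _
      · exact not_lt.1 hh

theorem eventually_lintegral_inner_le_diffQuotient_add (hΩ : IsOpen Ω) (hp : 1 < p)
    (hum : Measurable u) (hu : IsWeakGradient univ u g) (hgm : Measurable g)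
    (hg : MemLp g (ENNReal.ofReal p) volume) {η : ℝ≥0∞} (hη : 0 < η) :
    ∀ᶠ h in 𝓝[≠] (0 : EuclideanSpace ℝ (Fin d)),
      ∫⁻ x in Ω, ‖⟪g x, ‖h‖⁻¹ • h⟫_ℝ‖ₑ ^ p ≤ diffQuotient Ω p u h + η := by
  have hp0 : 0 < p := one_pos.trans hp
  have hG := (hg.lintegral_enorm_rpow_lt_top hp0).ne
  have hη2 : 0 < η / 2 := ENNReal.half_pos hη.ne'
  -- The two functions exchange roles compared with the upper bound, so an a priori bound on the
  -- difference quotient is required; the upper bound with error `1` supplies it.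
  obtain ⟨δ, hδ, hpert⟩ := exists_lintegral_rpow_le_add (α := EuclideanSpace ℝ (Fin d)) hp
    (C := (∫⁻ x, ‖g x‖ₑ ^ p) + 1) (ENNReal.add_ne_top.2 ⟨hG, ENNReal.one_ne_top⟩) hη2
  filter_upwards [eventually_lintegral_difference_quotient_sub_inner_le hp hu hgm hg hδ,
    self_mem_nhdsWithin, nhdsWithin_le_nhds (Metric.closedBall_mem_nhds 0 one_pos),
    eventually_diffQuotient_le_add (Ω := Ω) hp hum hu hgm hg one_pos,
    nhdsWithin_le_nhds ((tendsto_order.1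
      (tendsto_setLIntegral_diff_translate hΩ hgm hp0 hg)).2 _ hη2)] with h hq h0 h1 hle hdiff
  have hbound : diffQuotient Ω p u h ≤ (∫⁻ x, ‖g x‖ₑ ^ p) + 1 := hle.trans <|
    add_le_add_left ((lintegral_enorm_inner_unit_rpow_le hp0 _ h).trans
      (setLIntegral_le_lintegral _ _)) _
  have heq := diffQuotient_eq_lintegral (Ω := Ω) (u := u) hp0 h0 (mem_closedBall_zero_iff.1 h1)
  have hm : MeasurableSet {x | x - h ∈ Ω} := (hΩ.preimage (by fun_prop)).measurableSet
  have h2 : ∫⁻ x in Ω ∩ {x | x - h ∈ Ω}, ‖⟪g x, ‖h‖⁻¹ • h⟫_ℝ‖ₑ ^ p ≤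
      diffQuotient Ω p u h + η / 2 := by
    rw [heq] at hbound ⊢
    refine hpert _ _ _ (by fun_prop) (by fun_prop) ?_ hbound
    simp only [enorm_sub_rev (⟪_, _⟫_ℝ)]
    exact (setLIntegral_le_lintegral _ _).trans hq
  rw [← lintegral_inter_add_sdiff _ Ω hm]
  calc _ ≤ (diffQuotient Ω p u h + η / 2) + η / 2 :=
        add_le_add h2 ((lintegral_enorm_inner_unit_rpow_le hp0 _ h).trans hdiff.le)
    _ = _ := by rw [add_assoc, ENNReal.add_halves]

/-- Convergence of the nonlocal energies of a Sobolev function on the whole space. -/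
theorem tendsto_nonlocalEnergy (hd : 0 < d) (hp : 1 < p) (hΩ : IsOpen Ω)
    {ν : ℝ → EuclideanSpace ℝ (Fin d) → ℝ≥0∞} (hν : IsDiracApproximation p ν)
    (hum : Measurable u) (hup : MemLp u (ENNReal.ofReal p) volume)
    (hu : IsWeakGradient univ u g) (hgm : Measurable g)
    (hg : MemLp g (ENNReal.ofReal p) volume)
    {e : EuclideanSpace ℝ (Fin d)} (he : ‖e‖ = 1) :
    Tendsto (fun ε => nonlocalEnergy Ω p (ν ε) u) (𝓝[>] 0)
      (𝓝 (ENNReal.ofReal (sphereConst d p e) * ∫⁻ x in Ω, ‖g x‖ₑ ^ p)) := by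
  have hp0 : 0 < p := one_pos.trans hp
  have hG : ∫⁻ x in Ω, ‖g x‖ₑ ^ p < ⊤ :=
    (setLIntegral_le_lintegral _ _).trans_lt (hg.lintegral_enorm_rpow_lt_top hp0)
  -- The leading term has the same average for every `ε`, so the limit only concerns the error.
  have hΨ : ∀ ε, 0 < ε → ∫⁻ h, ∫⁻ x in Ω, ‖⟪g x, ‖h‖⁻¹ • h⟫_ℝ‖ₑ ^ p ∂volume
      ∂(levyMeasure p (ν ε)) = ENNReal.ofReal (sphereConst d p e) * ∫⁻ x in Ω, ‖g x‖ₑ ^ p := by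
    intro ε hε
    have := isProbabilityMeasure_levyMeasure (hν.integral_eq_one ε hε)
    rw [lintegral_lintegral_swap (Measurable.aemeasurable (by unfold Function.uncurry; fun_prop)),
      ← lintegral_const_mul' _ _ ENNReal.ofReal_ne_top]
    exact lintegral_congr fun x => lintegral_levyMeasure_inner hp0 hd (hν.measurable ε hε)
      (hν.radial ε hε) (hν.integral_eq_one ε hε) he (g x)
  obtain ⟨C, hC, hCle⟩ := exists_forall_diffQuotient_le (Ω := Ω) hp hum hup hu hgm hg
  rw [ENNReal.tendsto_nhds (ENNReal.mul_ne_top ENNReal.ofReal_ne_top hG.ne)]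
  intro η hη
  filter_upwards [self_mem_nhdsWithin,
    eventually_lintegral_levyMeasure_le_add hd hν hC hCle
      (fun η hη => eventually_diffQuotient_le_add hp hum hu hgm hg hη) hη,
    eventually_lintegral_levyMeasure_le_add hd hν hG.ne
      (fun h _ => lintegral_enorm_inner_unit_rpow_le hp0 Ω h)
      (fun η hη => eventually_lintegral_inner_le_diffQuotient_add hΩ hp hum hu hgm hg hη) hη]
    with ε hε h1 h2
  rw [hΨ ε hε] at h1 h2
  rw [nonlocalEnergy_eq_lintegral_diffQuotient hd hΩ.measurableSet hum (hν.measurable ε hε)]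
  exact ⟨tsub_le_iff_right.2 h2, h1⟩

end LimitOfEnergies

/-! ### Finite energy implies a weak gradient in `L^p` -/

section TestFunctions

variable {d : ℕ} {Ω : Set (EuclideanSpace ℝ (Fin d))} {u φ : EuclideanSpace ℝ (Fin d) → ℝ} {p : ℝ}

/-- The correlation of `u` with a test function is differentiable at the origin. -/
theorem exists_hasFDerivAt_integral_mul_translate (hu : LocallyIntegrable (fun x => u (-x)) volume)
    (h1 : ContDiff ℝ ∞ φ) (h2 : HasCompactSupport φ) :
    ∃ ℓ : EuclideanSpace ℝ (Fin d) →L[ℝ] ℝ,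
      HasFDerivAt (fun h => ∫ x, u x * φ (x + h)) ℓ 0 ∧ ∀ v, ℓ v = ∫ x, u x * fderiv ℝ φ x v := by
  -- The correlation is a convolution with the reflection of `u`, so smoothness of `φ` alone gives
  -- differentiability.
  have hneg : ∀ (ψ : EuclideanSpace ℝ (Fin d) → ℝ) (h : EuclideanSpace ℝ (Fin d)),
      convolution (fun x => u (-x)) ψ (ContinuousLinearMap.mul ℝ ℝ) volume h =
        ∫ x, u x * ψ (x + h) := by
    intro ψ h
    rw [convolution_def, ← integral_neg_eq_self (fun x => u x * ψ (x + h))]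
    refine integral_congr_ae (Eventually.of_forall fun x => ?_)
    simp [neg_add_eq_sub]
  refine ⟨_, (h2.hasFDerivAt_convolution_right (ContinuousLinearMap.mul ℝ ℝ) hu
    (h1.of_le (by simp)) 0).congr_of_eventuallyEq
      (Eventually.of_forall fun h => (hneg φ h).symm), fun v => ?_⟩
  rw [convolution_precompR_apply _ hu (h2.fderiv ℝ) (h1.continuous_fderiv (by simp)), hneg]
  simp

theorem eventually_forall_tsupport_sub_mem (hΩ : IsOpen Ω) (h2 : HasCompactSupport φ)
    (h3 : tsupport φ ⊆ Ω) :
    ∀ᶠ h in 𝓝 (0 : EuclideanSpace ℝ (Fin d)), ∀ x ∈ tsupport φ, x - h ∈ Ω := by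
  obtain ⟨δ, hδ, hsub⟩ := h2.isCompact.exists_thickening_subset_open hΩ h3
  filter_upwards [Metric.ball_mem_nhds 0 hδ] with h hh x hx
  refine hsub (Metric.mem_thickening_iff.2 ⟨x, hx, ?_⟩)
  simpa [dist_eq_norm] using hh

/-- A translation moves the difference from `φ` to `u`, and Hölder separates the factors. For `h`
small the integrand lives where both `x` and `x - h` belong to `Ω`, so only the energy inside `Ω`
enters. -/
theorem enorm_difference_quotient_correlation_rpow_le {q : ℝ} (hpq : p.HolderConjugate q)
    (hum : Measurable u) (hu : LocallyIntegrable u volume) (h1 : ContDiff ℝ ∞ φ)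
    (h2 : HasCompactSupport φ) (h3 : tsupport φ ⊆ Ω) {h : EuclideanSpace ℝ (Fin d)} (h0 : h ≠ 0)
    (hle : ‖h‖ ≤ 1) (hh : ∀ x ∈ tsupport φ, x - h ∈ Ω) :
    ‖‖h‖⁻¹ * ((∫ x, u x * φ (x + h)) - ∫ x, u x * φ x)‖ₑ ^ p ≤
      ((∫⁻ x in Ω, ‖φ x‖ₑ ^ q) ^ (1 / q)) ^ p * diffQuotient Ω p u h := by
  have hp0 : 0 < p := hpq.pos
  have hφc := h1.continuous
  have hi : ∀ ψ : EuclideanSpace ℝ (Fin d) → ℝ, Continuous ψ → HasCompactSupport ψ →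
      Integrable (fun x => u x * ψ x) volume := fun ψ hψ hc => by
    have := integrableOn_mul_of_tsupport_subset (hu.locallyIntegrableOn univ) hψ hc (subset_univ _)
    rwa [integrableOn_univ] at this
  have hi2 : Integrable (fun x => u (x - h) * φ x) volume := by
    have := (hi (fun x => φ (x + h)) (by fun_prop)
      (h2.comp_homeomorph (Homeomorph.addRight h))).comp_sub_right h
    simpa using this
  have e1 : ‖h‖⁻¹ * ((∫ x, u x * φ (x + h)) - ∫ x, u x * φ x) =
      ∫ x, ‖h‖⁻¹ * (u (x - h) - u x) * φ x := by
    rw [← integral_sub_right_eq_self (fun x => u x * φ (x + h)) h]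
    simp only [sub_add_cancel]
    rw [← integral_sub hi2 (hi φ hφc h2), ← integral_const_mul]
    exact integral_congr_ae (Eventually.of_forall fun x => by simp only; ring)
  rw [e1, diffQuotient_eq_lintegral hp0 h0 hle]
  have hφ0 : ∀ x, x ∉ Ω ∩ {x | x - h ∈ Ω} → φ x = 0 := fun x hx =>
    image_eq_zero_of_notMem_tsupport fun hx' => hx ⟨h3 hx', hh x hx'⟩
  calc ‖∫ x, ‖h‖⁻¹ * (u (x - h) - u x) * φ x‖ₑ ^ p
      ≤ (∫⁻ x, ‖‖h‖⁻¹ * (u (x - h) - u x) * φ x‖ₑ) ^ p := by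
        gcongr
        exact enorm_integral_le_lintegral_enorm _
    _ = (∫⁻ x in Ω ∩ {x | x - h ∈ Ω}, ‖‖h‖⁻¹ * (u x - u (x - h))‖ₑ * ‖φ x‖ₑ) ^ p := by
        congr 1
        rw [← setLIntegral_eq_of_support_subset
          (s := Ω ∩ {x | x - h ∈ Ω})]
        · refine lintegral_congr fun x => ?_
          rw [enorm_mul, enorm_mul, enorm_mul, enorm_sub_rev]
        · intro x hx
          by_contra hc
          exact hx (by simp [hφ0 x hc])
    _ ≤ ((∫⁻ x in Ω ∩ {x | x - h ∈ Ω}, ‖‖h‖⁻¹ * (u x - u (x - h))‖ₑ ^ p) ^ (1 / p) *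
          (∫⁻ x in Ω ∩ {x | x - h ∈ Ω}, ‖φ x‖ₑ ^ q) ^ (1 / q)) ^ p := by
        gcongr
        exact ENNReal.lintegral_mul_le_Lp_mul_Lq _ hpq (by fun_prop) (by fun_prop)
    _ ≤ _ := by
        rw [ENNReal.mul_rpow_of_nonneg _ _ hp0.le, one_div, ENNReal.rpow_inv_rpow hp0.ne', mul_comm]
        have hq0 := hpq.symm.pos
        gcongr
        exact inter_subset_left

/-- A function of finite energy defines a functional on test functions, bounded in `L^q`. -/
theorem exists_enorm_integral_mul_fderiv_le (hd : 0 < d) {q : ℝ} (hpq : p.HolderConjugate q)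
    (hΩ : IsOpen Ω) {ν : ℝ → EuclideanSpace ℝ (Fin d) → ℝ≥0∞} (hν : IsDiracApproximation p ν)
    (hum : Measurable u) (hup : MemLp u (ENNReal.ofReal p) volume)
    (hfin : liminfEnergy Ω p ν u < ⊤) :
    ∃ M : ℝ≥0∞, M ≠ ⊤ ∧ ∀ φ : EuclideanSpace ℝ (Fin d) → ℝ, ContDiff ℝ ∞ φ → HasCompactSupport φ →
      tsupport φ ⊆ Ω → ∀ v : EuclideanSpace ℝ (Fin d), ‖v‖ = 1 →
        ‖∫ x, u x * fderiv ℝ φ x v‖ₑ ≤ M * (∫⁻ x in Ω, ‖φ x‖ₑ ^ q) ^ (1 / q) := by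
  have hp0 : 0 < p := hpq.pos
  have hp1 : 1 ≤ ENNReal.ofReal p := by simpa using hpq.lt.le
  set A := liminfEnergy Ω p ν u with hA
  -- A liminf bounds the energy only for arbitrarily small `ε`; that is enough, since the comparison
  -- of averages holds for all small `ε`.
  have hAfreq : ∃ᶠ ε in 𝓝[>] (0 : ℝ), nonlocalEnergy Ω p (ν ε) u < A + 1 :=
    frequently_lt_of_liminf_lt (by isBoundedDefault) (ENNReal.lt_add_right hfin.ne one_ne_zero)
  have hul : LocallyIntegrable u volume := hup.locallyIntegrable hp1
  have huneg : LocallyIntegrable (fun x => u (-x)) volume :=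
    (hup.comp_measurePreserving (Measure.measurePreserving_neg volume)).locallyIntegrable hp1
  have : Nonempty (Fin d) := ⟨⟨0, hd⟩⟩
  obtain ⟨e, he⟩ := exists_norm_eq (EuclideanSpace ℝ (Fin d)) zero_le_one
  set K := ENNReal.ofReal (sphereConst d p e) with hK
  have hK0 : K ≠ 0 := ofReal_sphereConst_ne_zero hp0 hd he
  have hKt : K ≠ ⊤ := ENNReal.ofReal_ne_top
  refine ⟨((A + 1) / K) ^ (1 / p), ENNReal.rpow_ne_top_of_nonneg (by positivity)
    (ENNReal.div_lt_top (ENNReal.add_ne_top.2 ⟨hfin.ne, ENNReal.one_ne_top⟩) hK0).ne,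
    fun φ h1 h2 h3 v hv => ?_⟩
  obtain ⟨ℓ, hℓ, hℓv⟩ := exists_hasFDerivAt_integral_mul_translate huneg h1 h2
  set w := (InnerProductSpace.toDual ℝ (EuclideanSpace ℝ (Fin d))).symm ℓ with hw
  have hwℓ : ∀ h, ⟪w, h⟫_ℝ = ℓ h := fun h => InnerProductSpace.toDual_symm_apply
  set N := (∫⁻ x in Ω, ‖φ x‖ₑ ^ q) ^ (1 / q) with hN
  have hNt : N ≠ ⊤ := by
    refine ENNReal.rpow_ne_top_of_nonneg (by have := hpq.symm.pos; positivity) ?_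
    exact ((h1.continuous.memLp_of_hasCompactSupport h2).lintegral_enorm_rpow_lt_top
      hpq.symm.pos).ne
  -- Differentiability at `0` makes `⟪w, h/|h|⟫` the difference quotient of the correlation up to
  -- `o(1)`.
  have hcmp : ∀ η : ℝ≥0∞, 0 < η → ∀ᶠ h in 𝓝[≠] (0 : EuclideanSpace ℝ (Fin d)),
      ‖⟪w, ‖h‖⁻¹ • h⟫_ℝ‖ₑ ^ p ≤ N ^ p * diffQuotient Ω p u h + η := by
    intro η hη
    obtain ⟨δ, hδ, hpert⟩ := ENNReal.exists_rpow_le_rpow_add_of_le hp0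
      (enorm_ne_top (x := w)) hη
    obtain ⟨δ', hδ', hδδ⟩ := ENNReal.lt_iff_exists_nnreal_btwn.1 hδ
    have hδ'0 : 0 < (δ' : ℝ) := by exact_mod_cast hδ'
    have hlo := hℓ.isLittleO.def hδ'0
    filter_upwards [self_mem_nhdsWithin, nhdsWithin_le_nhds hlo,
      nhdsWithin_le_nhds (Metric.closedBall_mem_nhds 0 one_pos),
      nhdsWithin_le_nhds (eventually_forall_tsupport_sub_mem hΩ h2 h3)] with h h0 hh hball hmem
    have hn : 0 < ‖h‖ := norm_pos_iff.2 h0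
    simp only [sub_zero, add_zero] at hh
    refine (hpert _ _ ?_ ?_).trans (add_le_add_left
      (enorm_difference_quotient_correlation_rpow_le hpq hum hul h1 h2 h3 h0
        (mem_closedBall_zero_iff.1 hball) hmem) _)
    · refine (enorm_real_inner_le _ _).trans (mul_le_of_le_one_right' ?_)
      rw [← ofReal_norm, ENNReal.ofReal_le_one, norm_smul, norm_inv, norm_norm]
      exact inv_mul_le_one
    · set D := (∫ x, u x * φ (x + h)) - ∫ x, u x * φ x
      have h4 : ‖‖h‖⁻¹ * (D - ℓ h)‖ₑ ≤ δ' := by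
        rw [← ofReal_norm, norm_mul, norm_inv, norm_norm, ← ENNReal.ofReal_coe_nnreal]
        refine ENNReal.ofReal_le_ofReal ?_
        rw [inv_mul_le_iff₀ hn, mul_comm]
        exact hh
      calc ‖⟪w, ‖h‖⁻¹ • h⟫_ℝ‖ₑ = ‖‖h‖⁻¹ * D - ‖h‖⁻¹ * (D - ℓ h)‖ₑ := by
            rw [hwℓ, map_smul, smul_eq_mul]; congr 1; ring
        _ ≤ ‖‖h‖⁻¹ * D‖ₑ + ‖‖h‖⁻¹ * (D - ℓ h)‖ₑ := enorm_sub_le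
        _ ≤ _ := add_le_add_right (h4.trans hδδ.le) _
  have hmain : K * ‖w‖ₑ ^ p ≤ (A + 1) * N ^ p := by
    refine ENNReal.le_of_forall_pos_le_add fun η hη _ => ?_
    have h4 := eventually_lintegral_levyMeasure_le_add hd hν
      (C := ‖w‖ₑ ^ p) (ENNReal.rpow_ne_top_of_nonneg hp0.le enorm_ne_top) (fun h _ => by
        refine ENNReal.rpow_le_rpow ?_ hp0.le
        refine (enorm_real_inner_le _ _).trans (mul_le_of_le_one_right' ?_)
        rw [← ofReal_norm, ENNReal.ofReal_le_one, norm_smul, norm_inv, norm_norm]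
        exact inv_mul_le_one) hcmp (η := η) (by exact_mod_cast hη)
    obtain ⟨ε, hε1, hε2, hε⟩ := (hAfreq.and_eventually (h4.and self_mem_nhdsWithin)).exists
    rw [lintegral_levyMeasure_inner hp0 hd (hν.measurable ε hε) (hν.radial ε hε)
      (hν.integral_eq_one ε hε) he, lintegral_const_mul' _ _
        (ENNReal.rpow_ne_top_of_nonneg hp0.le hNt), ← nonlocalEnergy_eq_lintegral_diffQuotient hd
        hΩ.measurableSet hum (hν.measurable ε hε)] at hε2
    refine hε2.trans ?_
    rw [mul_comm]
    gcongr
  have hwN : ‖w‖ₑ ≤ ((A + 1) / K) ^ (1 / p) * N := by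
    have h4 : ‖w‖ₑ ^ p ≤ (A + 1) / K * N ^ p := by
      rw [← ENNReal.mul_div_right_comm, ENNReal.le_div_iff_mul_le (Or.inl hK0) (Or.inl hKt),
        mul_comm]
      exact hmain
    rw [one_div]
    calc ‖w‖ₑ = (‖w‖ₑ ^ p) ^ p⁻¹ := (ENNReal.rpow_rpow_inv hp0.ne' _).symm
      _ ≤ ((A + 1) / K * N ^ p) ^ p⁻¹ := by gcongr
      _ = _ := by rw [ENNReal.mul_rpow_of_nonneg _ _ (by positivity), ENNReal.rpow_rpow_inv hp0.ne']
  rw [← hℓv, ← hwℓ]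
  refine ((enorm_real_inner_le _ _).trans ?_).trans hwN
  rw [← ofReal_norm v, hv, ENNReal.ofReal_one, mul_one]

/-- Smooth functions with compact support in `Ω`. -/
def testFunctions (Ω : Set (EuclideanSpace ℝ (Fin d))) :
    Submodule ℝ (EuclideanSpace ℝ (Fin d) → ℝ) where
  carrier := {φ | ContDiff ℝ ∞ φ ∧ HasCompactSupport φ ∧ tsupport φ ⊆ Ω}
  zero_mem' := ⟨contDiff_const, HasCompactSupport.zero, by simp [tsupport]⟩
  add_mem' := fun {φ ψ} hφ hψ => ⟨hφ.1.add hψ.1, hφ.2.1.add hψ.2.1,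
    (tsupport_add φ ψ).trans (union_subset hφ.2.2 hψ.2.2)⟩
  smul_mem' := fun c φ hφ => ⟨hφ.1.const_smul c, hφ.2.1.smul_left,
    (tsupport_smul_subset_right (fun _ => c) φ).trans hφ.2.2⟩

theorem testFunctions.memLp (φ : testFunctions Ω) (q : ℝ≥0∞) :
    MemLp (φ : EuclideanSpace ℝ (Fin d) → ℝ) q (volume.restrict Ω) :=
  φ.2.1.continuous.memLp_of_hasCompactSupport φ.2.2.1

/-- Riesz representation with the test functions as domain of the functional: no density in `L^q`
and no extension to `L^q` is needed. -/
theorem exists_memLp_integral_mul_fderiv_eq {q : ℝ} (hpq : p.HolderConjugate q)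
    (hu : LocallyIntegrableOn u Ω volume) {M : ℝ≥0∞} (hM : M ≠ ⊤) (v : EuclideanSpace ℝ (Fin d))
    (hbd : ∀ φ : EuclideanSpace ℝ (Fin d) → ℝ, ContDiff ℝ ∞ φ → HasCompactSupport φ →
      tsupport φ ⊆ Ω → ‖∫ x in Ω, u x * fderiv ℝ φ x v‖ₑ ≤
        M * (∫⁻ x in Ω, ‖φ x‖ₑ ^ q) ^ (1 / q)) :
    ∃ k : EuclideanSpace ℝ (Fin d) → ℝ, MemLp k (ENNReal.ofReal p) (volume.restrict Ω) ∧
      ∀ φ : EuclideanSpace ℝ (Fin d) → ℝ, ContDiff ℝ ∞ φ → HasCompactSupport φ → tsupport φ ⊆ Ω →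
        ∫ x in Ω, u x * fderiv ℝ φ x v = ∫ x in Ω, k x * φ x := by
  have hq0 := hpq.symm.pos
  let ι : testFunctions Ω →ₗ[ℝ] Lp ℝ (ENNReal.ofReal q) (volume.restrict Ω) :=
    { toFun := fun φ => (testFunctions.memLp φ _).toLp φ
      map_add' := fun φ ψ => rfl
      map_smul' := fun c φ => rfl }
  have hint : ∀ φ : testFunctions Ω,
      Integrable (fun x => u x * fderiv ℝ (φ : EuclideanSpace ℝ (Fin d) → ℝ) x v)
        (volume.restrict Ω) := fun φ =>
    integrableOn_mul_of_tsupport_subset hu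
      ((φ.2.1.continuous_fderiv (by simp)).clm_apply continuous_const)
      (φ.2.2.1.of_isClosed_subset (isClosed_tsupport _) (tsupport_fderiv_apply_subset ℝ v))
      ((tsupport_fderiv_apply_subset ℝ v).trans φ.2.2.2)
  have hdiff : ∀ φ : testFunctions Ω, Differentiable ℝ (φ : EuclideanSpace ℝ (Fin d) → ℝ) :=
    fun φ => φ.2.1.differentiable (by simp)
  let ℓ : testFunctions Ω →ₗ[ℝ] ℝ :=
    { toFun := fun φ => ∫ x in Ω, u x * fderiv ℝ (φ : EuclideanSpace ℝ (Fin d) → ℝ) x v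
      map_add' := fun φ ψ => by
        rw [← integral_add (hint φ) (hint ψ)]
        refine integral_congr_ae (Eventually.of_forall fun x => ?_)
        simp only [Submodule.coe_add]
        rw [fderiv_add (hdiff φ x) (hdiff ψ x), add_apply, mul_add]
      map_smul' := fun c φ => by
        rw [RingHom.id_apply, smul_eq_mul, ← integral_const_mul]
        refine integral_congr_ae (Eventually.of_forall fun x => ?_)
        simp only [Submodule.coe_smul]
        rw [fderiv_const_smul (hdiff φ x), smul_apply, smul_eq_mul]
        ring }
  have hbound : ∀ φ, |ℓ φ| ≤ M.toReal * ‖ι φ‖ := by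
    intro φ
    have h1 := hbd φ φ.2.1 φ.2.2.1 φ.2.2.2
    have h2 : eLpNorm (φ : EuclideanSpace ℝ (Fin d) → ℝ) (ENNReal.ofReal q) (volume.restrict Ω) =
        (∫⁻ x in Ω, ‖(φ : EuclideanSpace ℝ (Fin d) → ℝ) x‖ₑ ^ q) ^ (1 / q) := by
      rw [eLpNorm_eq_lintegral_rpow_enorm_toReal (by simpa) ENNReal.ofReal_ne_top,
        ENNReal.toReal_ofReal hq0.le]
    rw [← h2] at h1
    have h3 := ENNReal.toReal_mono
      (ENNReal.mul_ne_top hM (testFunctions.memLp φ (ENNReal.ofReal q)).2.ne) h1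
    rw [ENNReal.toReal_mul, toReal_enorm] at h3
    exact h3.trans_eq (by rw [← Lp.norm_toLp _ (testFunctions.memLp φ (ENNReal.ofReal q))]; rfl)
  obtain ⟨k, hk, hkℓ⟩ := exists_memLp_forall_eq_integral hpq ι ℓ ENNReal.toReal_nonneg hbound
  refine ⟨k, hk, fun φ h1 h2 h3 => (hkℓ ⟨φ, h1, h2, h3⟩).trans ?_⟩
  refine integral_congr_ae ?_
  filter_upwards [(testFunctions.memLp (⟨φ, h1, h2, h3⟩ : testFunctions Ω)
    (ENNReal.ofReal q)).coeFn_toLp] with x hx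
  exact congrArg (k x * ·) hx

/-- Functions of finite energy have a weak gradient in `L^p`. -/
theorem exists_isLpWeakGradient (hd : 0 < d) (hp : 1 < p) (hΩ : IsOpen Ω)
    {ν : ℝ → EuclideanSpace ℝ (Fin d) → ℝ≥0∞} (hν : IsDiracApproximation p ν)
    (hum : Measurable u) (hup : MemLp u (ENNReal.ofReal p) volume)
    (hfin : liminfEnergy Ω p ν u < ⊤) : ∃ g, IsLpWeakGradient Ω p u g := by
  have hpq := Real.HolderConjugate.conjExponent hp
  have hp1 : 1 ≤ ENNReal.ofReal p := by simpa using hp.le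
  have hul : LocallyIntegrableOn u Ω volume := (hup.locallyIntegrable hp1).locallyIntegrableOn Ω
  obtain ⟨M, hM, hbd⟩ := exists_enorm_integral_mul_fderiv_le hd hpq hΩ hν hum hup hfin
  have hset : ∀ φ : EuclideanSpace ℝ (Fin d) → ℝ, tsupport φ ⊆ Ω → ∀ v,
      ∫ x in Ω, u x * fderiv ℝ φ x v = ∫ x, u x * fderiv ℝ φ x v := fun φ h3 v =>
    setIntegral_eq_integral_of_forall_compl_eq_zero fun x hx => by
      have : fderiv ℝ φ x = 0 :=
        image_eq_zero_of_notMem_tsupport fun hx' => hx (h3 (tsupport_fderiv_subset ℝ hx'))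
      simp [this]
  have hex : ∀ i : Fin d, _ := fun i =>
    exists_memLp_integral_mul_fderiv_eq hpq hul hM (EuclideanSpace.single i (1 : ℝ))
      fun φ h1 h2 h3 => by
        rw [hset φ h3]
        exact hbd φ h1 h2 h3 _ (by simp)
  choose k hk hkφ using hex
  -- The sign comes from integration by parts: `k i` represents `φ ↦ ∫ u ∂ᵢφ`, which is `- ∫ gᵢ φ`.
  let g : EuclideanSpace ℝ (Fin d) → EuclideanSpace ℝ (Fin d) := fun x =>
    ∑ i, (-k i x) • EuclideanSpace.single i (1 : ℝ)
  have hg : ∀ x i, g x i = -k i x := fun x i => by simp [g, Pi.single_apply]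
  have hgp : MemLp g (ENNReal.ofReal p) (volume.restrict Ω) :=
    memLp_finsetSum _ fun i _ =>
      (ContinuousLinearMap.toSpanSingleton ℝ (EuclideanSpace.single i (1 : ℝ))).comp_memLp'
        (hk i).neg
  refine ⟨g, ⟨hul, locallyIntegrableOn_of_locallyIntegrable_restrict (hgp.locallyIntegrable hp1),
    fun φ h1 h2 h3 i => ?_⟩, hgp⟩
  rw [hkφ i φ h1 h2 h3, ← integral_neg]
  simp only [hg, neg_mul, neg_neg]

end TestFunctions

/-! ### Uniqueness of gradients, and passage between `Ω` and the whole space -/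

section WeakGradientUniqueness

variable {d : ℕ} {Ω : Set (EuclideanSpace ℝ (Fin d))} {u v : EuclideanSpace ℝ (Fin d) → ℝ}
  {g k : EuclideanSpace ℝ (Fin d) → EuclideanSpace ℝ (Fin d)} {p : ℝ}

theorem IsWeakGradient.ae_eq (hΩ : IsOpen Ω) (hg : IsWeakGradient Ω u g)
    (hk : IsWeakGradient Ω u k) : g =ᵐ[volume.restrict Ω] k := by
  have hi : ∀ i : Fin d, ∀ᵐ x ∂(volume : Measure (EuclideanSpace ℝ (Fin d))),
      x ∈ Ω → g x i - k x i = 0 := by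
    intro i
    refine hΩ.ae_eq_zero_of_integral_contDiff_smul_eq_zero
      ((locallyIntegrableOn_coord hg.locallyIntegrableOn_grad i).sub
        (locallyIntegrableOn_coord hk.locallyIntegrableOn_grad i)) fun φ h1 h2 h3 => ?_
    have e1 := hg.integral_eq φ h1 h2 h3 i
    rw [hk.integral_eq φ h1 h2 h3 i, neg_inj] at e1
    have e2 : ∫ x in Ω, (g x i - k x i) * φ x = 0 := by
      simp only [sub_mul]
      rw [integral_sub (hg.integrable_right h1 h2 h3 i) (hk.integrable_right h1 h2 h3 i), e1,
        sub_self]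
    rw [← e2, setIntegral_eq_integral_of_forall_compl_eq_zero]
    · exact integral_congr_ae (Eventually.of_forall fun x => by simp [mul_comm])
    · intro x hx
      rw [image_eq_zero_of_notMem_tsupport fun hx' => hx (h3 hx'), mul_zero]
  rw [EventuallyEq, ae_restrict_iff' hΩ.measurableSet]
  filter_upwards [ae_all_iff.2 hi] with x hx hxΩ
  ext i
  exact sub_eq_zero.1 (hx i hxΩ)

theorem IsWeakGradient.mono_of_univ (hg : IsWeakGradient univ u g) (Ω) : IsWeakGradient Ω u g where
  locallyIntegrableOn := hg.locallyIntegrableOn.mono_set (subset_univ _)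
  locallyIntegrableOn_grad := hg.locallyIntegrableOn_grad.mono_set (subset_univ _)
  integral_eq φ h1 h2 h3 i := by
    have h := hg.integral_eq φ h1 h2 (subset_univ _) i
    rw [Measure.restrict_univ] at h
    rw [setIntegral_eq_integral_of_forall_compl_eq_zero, h,
      setIntegral_eq_integral_of_forall_compl_eq_zero]
    · intro x hx
      rw [image_eq_zero_of_notMem_tsupport fun hx' => hx (h3 hx'), mul_zero]
    · intro x hx
      have : fderiv ℝ φ x = 0 :=
        image_eq_zero_of_notMem_tsupport fun hx' => hx (h3 (tsupport_fderiv_subset ℝ hx'))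
      simp [this]

theorem IsWeakGradient.congr_grad_univ (hg : IsWeakGradient univ u g) (h : g =ᵐ[volume] k) :
    IsWeakGradient univ u k where
  locallyIntegrableOn := hg.locallyIntegrableOn
  locallyIntegrableOn_grad := by
    have := locallyIntegrableOn_univ.1 hg.locallyIntegrableOn_grad
    exact locallyIntegrableOn_univ.2 (this.congr h)
  integral_eq φ h1 h2 h3 i := by
    rw [hg.integral_eq φ h1 h2 h3 i, Measure.restrict_univ]
    congr 1
    refine integral_congr_ae ?_
    filter_upwards [h] with x hx
    rw [hx]

theorem IsLpWeakGradient.congr (hg : IsLpWeakGradient Ω p u g)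
    (h : v =ᵐ[volume.restrict Ω] u) : IsLpWeakGradient Ω p v g :=
  ⟨hg.1.congr h, hg.2⟩

theorem gradEnergy_eq_lintegral (hΩ : IsOpen Ω) (hg : IsLpWeakGradient Ω p u g) :
    gradEnergy Ω p u = ∫⁻ x in Ω, ‖g x‖ₑ ^ p := by
  refine le_antisymm (iInf₂_le g hg) (le_iInf₂ fun k hk => le_of_eq (lintegral_congr_ae ?_))
  filter_upwards [hg.1.ae_eq hΩ hk.1] with x hx
  rw [hx]

theorem gradEnergy_eq_top (h : ¬ ∃ g, IsLpWeakGradient Ω p u g) : gradEnergy Ω p u = ⊤ :=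
  iInf₂_eq_top.2 fun g hg => absurd ⟨g, hg⟩ h

theorem nonlocalEnergy_congr {κ : EuclideanSpace ℝ (Fin d) → ℝ≥0∞}
    (h : u =ᵐ[volume.restrict Ω] v) : nonlocalEnergy Ω p κ u = nonlocalEnergy Ω p κ v := by
  refine lintegral_congr_ae ?_
  filter_upwards [h] with x hx
  refine lintegral_congr_ae ?_
  filter_upwards [h] with y hy
  rw [hx, hy]

theorem liminfEnergy_congr {ν : ℝ → EuclideanSpace ℝ (Fin d) → ℝ≥0∞}
    (h : u =ᵐ[volume.restrict Ω] v) : liminfEnergy Ω p ν u = liminfEnergy Ω p ν v := by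
  simp only [liminfEnergy, nonlocalEnergy_congr h]

/-- A Sobolev function on an extension domain agrees on the domain with a Sobolev function on the
whole space. -/
theorem IsW1pExtensionDomain.exists_extension (hΩ : IsW1pExtensionDomain Ω p)
    (hu : MemW1p Ω p u) : ∃ v G, Measurable v ∧ Measurable G ∧ MemLp v (ENNReal.ofReal p) volume ∧
      MemLp G (ENNReal.ofReal p) volume ∧ IsWeakGradient univ v G ∧ v =ᵐ[volume.restrict Ω] u := by
  obtain ⟨-, T, C, hT⟩ := hΩ
  obtain ⟨hup, g, hg⟩ := hu
  let U : W1p Ω p := ⟨hup.toLp u, Lp.memLp _, g, hg.congr hup.coeFn_toLp⟩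
  obtain ⟨hvp, G, hG, hGp⟩ := (T U).2
  have hvm := (Lp.stronglyMeasurable (T U).1).measurable
  have hvu : ⇑(T U).1 =ᵐ[volume.restrict Ω] u := by
    filter_upwards [(hT U).1, hup.coeFn_toLp] with x hx hx'
    exact hx.trans hx'
  generalize ⇑(T U).1 = v at hvp hG hvm hvu
  rw [Measure.restrict_univ] at hvp hGp
  exact ⟨v, hGp.1.mk G, hvm, hGp.1.stronglyMeasurable_mk.measurable, hvp,
    hGp.ae_eq hGp.1.ae_eq_mk, hG.congr_grad_univ hGp.1.ae_eq_mk, hvu⟩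

theorem MemW1p.tendsto_nonlocalEnergy (hd : 0 < d) (hp : 1 < p) (hΩ : IsW1pExtensionDomain Ω p)
    {ν : ℝ → EuclideanSpace ℝ (Fin d) → ℝ≥0∞} (hν : IsDiracApproximation p ν)
    (hu : MemW1p Ω p u) {e : EuclideanSpace ℝ (Fin d)} (he : ‖e‖ = 1) :
    gradEnergy Ω p u ≠ ⊤ ∧ Tendsto (fun ε => nonlocalEnergy Ω p (ν ε) u) (𝓝[>] 0)
      (𝓝 (ENNReal.ofReal (sphereConst d p e) * gradEnergy Ω p u)) := by
  obtain ⟨v, G, hvm, hGm, hvp, hGp, hG, hvu⟩ := hΩ.exists_extension hu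
  have hGu : IsLpWeakGradient Ω p u G := ⟨(hG.mono_of_univ Ω).congr hvu.symm, hGp.restrict Ω⟩
  rw [gradEnergy_eq_lintegral hΩ.1 hGu]
  refine ⟨(hGu.2.lintegral_enorm_rpow_lt_top (one_pos.trans hp)).ne, ?_⟩
  simp only [← nonlocalEnergy_congr hvu]
  exact _root_.tendsto_nonlocalEnergy hd hp hΩ.1 hν hvm hvp hG hGm hGp he

/-- The energy sees `u` only almost everywhere on `Ω`, so `u` may be replaced by the zero extension
of a measurable representative. Openness of `Ω` suffices in this direction. -/
theorem memW1p_of_liminfEnergy_lt_top (hd : 0 < d) (hp : 1 < p) (hΩ : IsOpen Ω)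
    {ν : ℝ → EuclideanSpace ℝ (Fin d) → ℝ≥0∞} (hν : IsDiracApproximation p ν)
    (hu : MemLp u (ENNReal.ofReal p) (volume.restrict Ω)) (hfin : liminfEnergy Ω p ν u < ⊤) :
    MemW1p Ω p u := by
  have hmk : Ω.indicator (hu.1.mk u) =ᵐ[volume.restrict Ω] u := by
    filter_upwards [hu.1.ae_eq_mk, ae_restrict_mem hΩ.measurableSet] with x hx hxΩ
    rw [indicator_of_mem hxΩ, ← hx]
  have hup : MemLp (Ω.indicator (hu.1.mk u)) (ENNReal.ofReal p) volume :=
    (memLp_indicator_iff_restrict hΩ.measurableSet).2 (hu.ae_eq hu.1.ae_eq_mk)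
  rw [← liminfEnergy_congr hmk] at hfin
  obtain ⟨g, hg⟩ := exists_isLpWeakGradient hd hp hΩ hν
    (hu.1.stronglyMeasurable_mk.measurable.indicator hΩ.measurableSet) hup hfin
  exact ⟨hu, g, hg.congr hmk.symm⟩

end WeakGradientUniqueness

/-! ### The characterization and the limit -/

theorem theorem1p3 {d : ℕ} (hd : 0 < d) {p : ℝ} (hp : 1 < p)
    {Ω : Set (EuclideanSpace ℝ (Fin d))} (hΩ : IsW1pExtensionDomain Ω p)
    {ν : ℝ → EuclideanSpace ℝ (Fin d) → ℝ≥0∞} (hν : IsDiracApproximation p ν)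
    {u : EuclideanSpace ℝ (Fin d) → ℝ}
    (hu : MemLp u (ENNReal.ofReal p) (volume.restrict Ω)) :
    (MemW1p Ω p u ↔ liminfEnergy Ω p ν u < ⊤) ∧
    ∀ e : EuclideanSpace ℝ (Fin d), ‖e‖ = 1 →
      Tendsto (fun ε => nonlocalEnergy Ω p (ν ε) u) (𝓝[>] 0)
        (𝓝 (ENNReal.ofReal (sphereConst d p e) * gradEnergy Ω p u)) := by
  have hiff : MemW1p Ω p u ↔ liminfEnergy Ω p ν u < ⊤ := by
    refine ⟨fun h => ?_, memW1p_of_liminfEnergy_lt_top hd hp hΩ.1 hν hu⟩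
    have : Nonempty (Fin d) := ⟨⟨0, hd⟩⟩
    obtain ⟨e, he⟩ := exists_norm_eq (EuclideanSpace ℝ (Fin d)) zero_le_one
    obtain ⟨hfin, hlim⟩ := h.tendsto_nonlocalEnergy hd hp hΩ hν he
    rw [liminfEnergy, hlim.liminf_eq]
    exact ENNReal.mul_lt_top ENNReal.ofReal_lt_top hfin.lt_top
  refine ⟨hiff, fun e he => ?_⟩
  by_cases h : MemW1p Ω p u
  · exact (h.tendsto_nonlocalEnergy hd hp hΩ hν he).2
  · rw [gradEnergy_eq_top fun hg => h ⟨hu, hg⟩,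
      ENNReal.mul_top (ofReal_sphereConst_ne_zero (one_pos.trans hp) hd he)]
    have htop : liminfEnergy Ω p ν u = ⊤ := by
      by_contra hne
      exact h (hiff.2 (lt_top_iff_ne_top.2 hne))
    -- Once the liminf is `⊤`, the limsup bound is trivial.
    exact tendsto_of_le_liminf_of_limsup_le htop.ge le_top
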